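/- Let $(Q,\mathfrak n)$ be a commutative noetherian local ring, and let $f,g\in\mathfrak n\smallsetminus\mathfrak n^2$ with $fg=0$. Set $R=Q/(f)$. Let $A=Q\langle y,t\mid \partial y=f,\ \partial t=gy\rangle$ be the Tate construction, that is, the graded commutative dg $Q$-algebra which is free as a graded $Q$-module on the basis $y_{2i}=t^{(i)}$ (degree $2i$), $y_{2i+1}=t^{(i)}y$ (degree $2i+1$), $i\ge 0$, with unit $t^{(0)}$, with multiplication determined by $y^2=0$, $y\,t^{(i)}=t^{(i)}y$ and $t^{(i)}t^{(j)}=\frac{(i+j)!}{i!\,j!}t^{(i+j)}$, and with differential $\partial(t^{(0)})=0$, $\partial(t^{(i)})=g\,y\,t^{(i-1)}$ for $i\ge 1$, and $\partial(y\,t^{(i)})=f\,t^{(i)}$ for $i\ge 0$. Regard $R=H_0(A)$ as a dg $A$-module through the canonical augmentation $A\to R$. Let $M$ be a finitely generated $R$-module and let $U$, with augmentation $\varepsilon\colon U_0\to M$, be a minimal free resolution of $M$ over $Q$. For a complex $W$ or a dg algebra $A$, the underlying graded object is denoted $W^\#$, $A^\#$. (a) The complex $U$ has a structure of semi-free dg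 module over $A$; that is, there is a graded $A^\#$-module structure on $U^\#$, extending its $Q$-module structure, such that $\partial(au)=(\partial a)u+(-1)^{|a|}a(\partial u)$ for all homogeneous $a\in A$ and all $u\in U$, and such that $U^\#$ has a basis over $A^\#$ consisting of homogeneous elements. (b) Suppose moreover that $(f,g)$ is a pair of exact zero divisors, that is, $\operatorname{ann}(f)=(g)$ and $\operatorname{ann}(g)=(f)$. Then, for every semi-free dg $A$-module structure on $U$ as in (a), the complex $U\otimes_A R$, with the augmentation $(U\otimes_A R)_0\to M$ induced by $\varepsilon$ (so that $u\otimes 1\mapsto\varepsilon(u)$), is a minimal free resolution of $M$ over $R$. -/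

import Mathlib

open CategoryTheory
open scoped DirectSum TensorProduct

universe u v w

noncomputable section

namespace DGTate

/-! ### Dg algebras, complexes and dg modules -/

section General

variable {Q : Type u} [CommRing Q]

/-- `(A, 𝒜, d)` is a dg algebra over `Q`: a non-negatively graded `Q`-algebra, graded commutative
(with odd elements of square zero), with a `Q`-linear differential of degree `-1` satisfying the
Leibniz formula. -/
structure IsDGAlgebra {A : Type w} [Ring A] [Algebra Q A] (𝒜 : ℕ → Submodule Q A)
    (d : A →ₗ[Q] A) : Prop where
  isInternal : DirectSum.IsInternal 𝒜
  gradedMonoid : SetLike.GradedMonoid 𝒜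
  mul_comm_sign : ∀ ⦃i j : ℕ⦄ ⦃a b : A⦄, a ∈ 𝒜 i → b ∈ 𝒜 j → a * b = (-1) ^ (i * j) * (b * a)
  sq_odd : ∀ ⦃i : ℕ⦄ ⦃a : A⦄, Odd i → a ∈ 𝒜 i → a * a = 0
  d_zero : ∀ ⦃a : A⦄, a ∈ 𝒜 0 → d a = 0
  d_mem : ∀ ⦃i : ℕ⦄ ⦃a : A⦄, a ∈ 𝒜 (i + 1) → d a ∈ 𝒜 i
  d_d : ∀ a : A, d (d a) = 0
  leibniz : ∀ ⦃i : ℕ⦄ ⦃a : A⦄, a ∈ 𝒜 i → ∀ b : A, d (a * b) = d a * b + (-1) ^ i * (a * d b)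

/-- The underlying graded module `U^#` of a complex `U`, as the direct sum of its components. -/
abbrev Total (U : ChainComplex (ModuleCat.{v} Q) ℕ) : Type v := ⨁ n : ℕ, U.X n

/-- The degree `n` part of `U^#`. -/
def totalDeg (U : ChainComplex (ModuleCat.{v} Q) ℕ) (n : ℕ) : Submodule Q (Total U) :=
  LinearMap.range (DirectSum.lof Q ℕ (fun n => U.X n) n)

/-- The differential of `U` on `U^#`. In degree `0` it is the map `U.d 0 0`, which is zero. -/
def totalD (U : ChainComplex (ModuleCat.{v} Q) ℕ) : Total U →ₗ[Q] Total U :=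
  DirectSum.toModule Q ℕ (Total U)
    (fun n => (DirectSum.lof Q ℕ (fun n => U.X n) (n - 1)).comp (U.d n (n - 1)).hom)

/-- A given `A^#`-module structure on `U^#` makes the complex `U` of `Q`-modules a dg module over
the dg algebra `(A, 𝒜, d)`: the structure extends the `Q`-module structure of `U`, it is graded,
and the Leibniz formula holds. -/
structure IsDGModule {A : Type w} [Ring A] [Algebra Q A] (𝒜 : ℕ → Submodule Q A) (d : A →ₗ[Q] A)
    (U : ChainComplex (ModuleCat.{v} Q) ℕ) [Module A (Total U)] : Prop where
  isScalarTower : IsScalarTower Q A (Total U)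
  smul_mem : ∀ ⦃i j : ℕ⦄ ⦃a : A⦄ ⦃x : Total U⦄,
    a ∈ 𝒜 i → x ∈ totalDeg U j → a • x ∈ totalDeg U (i + j)
  leibniz : ∀ ⦃i : ℕ⦄ ⦃a : A⦄, a ∈ 𝒜 i → ∀ x : Total U,
    totalD U (a • x) = d a • x + (-1 : ℤ) ^ i • a • totalD U x

/-- The module `U^#` is free as a graded `A^#`-module: it has a basis of homogeneous elements.
As `U` is concentrated in non-negative degrees, for a dg module `U` this says that `U` is
semi-free. -/
def IsSemifree (A : Type w) [Ring A] (U : ChainComplex (ModuleCat.{v} Q) ℕ)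
    [Module A (Total U)] : Prop :=
  ∃ (ι : Type v) (deg : ι → ℕ) (b : Module.Basis ι A (Total U)), ∀ i, b i ∈ totalDeg U (deg i)

/-- The complex `C`, together with the augmentation `ε : C₀ → M`, is a minimal free resolution
of the module `M` over the local ring `S`. -/
structure IsMinimalFreeResolution {S : Type u} [CommRing S] [IsLocalRing S]
    (C : ChainComplex (ModuleCat.{v} S) ℕ) {M : Type w} [AddCommGroup M] [Module S M]
    (ε : C.X 0 →ₗ[S] M) : Prop where
  free : ∀ n, Module.Free S (C.X n)
  finite : ∀ n, Module.Finite S (C.X n)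
  exact_succ : ∀ n, Function.Exact (C.d (n + 2) (n + 1)).hom (C.d (n + 1) n).hom
  exact_zero : Function.Exact (C.d 1 0).hom ε
  surjective : Function.Surjective ε
  minimal : ∀ n, LinearMap.range (C.d (n + 1) n).hom ≤
    IsLocalRing.maximalIdeal S • (⊤ : Submodule S (C.X n))

/-- `(f, g)` is a pair of exact zero divisors: `ann(f) = (g)` and `ann(g) = (f)`. -/
def IsExactZeroDivisorPair (f g : Q) : Prop :=
  (Ideal.span {f}).annihilator = Ideal.span {g} ∧ (Ideal.span {g}).annihilator = Ideal.span {f}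

theorem totalD_lof_zero (U : ChainComplex (ModuleCat.{v} Q) ℕ) (x : U.X 0) :
    totalD U (DirectSum.lof Q ℕ (fun n => U.X n) 0 x) = 0 := by
  simp [totalD, DirectSum.toModule_lof]

theorem totalD_lof_succ (U : ChainComplex (ModuleCat.{v} Q) ℕ) (n : ℕ) (x : U.X (n + 1)) :
    totalD U (DirectSum.lof Q ℕ (fun n => U.X n) (n + 1) x) =
      DirectSum.lof Q ℕ (fun n => U.X n) n ((U.d (n + 1) n).hom x) := by
  simp [totalD, DirectSum.toModule_lof]

theorem totalD_totalD (U : ChainComplex (ModuleCat.{v} Q) ℕ) (x : Total U) :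
    totalD U (totalD U x) = 0 := by
  have h : (totalD U).comp (totalD U) = 0 := by
    refine DirectSum.linearMap_ext Q fun n => LinearMap.ext fun x => ?_
    simp only [LinearMap.comp_apply, LinearMap.zero_apply]
    rcases n with _ | _ | n
    · rw [totalD_lof_zero, map_zero]
    · rw [totalD_lof_succ, totalD_lof_zero]
    · rw [totalD_lof_succ, totalD_lof_succ]
      have := congrArg (fun φ => φ.hom x) (U.d_comp_d (n + 1 + 1) (n + 1) n)
      simp only [ModuleCat.hom_comp, LinearMap.comp_apply, ModuleCat.hom_zero,
        LinearMap.zero_apply] at this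
      rw [this, map_zero]
  exact LinearMap.congr_fun h x

end General

/-! ### The Tate construction `Q⟨y, t | ∂y = f, ∂t = g y⟩` -/

/-- The graded algebra `Q⟨y⟩ ⊗ Q⟨t⟩`, where `y` is an exterior variable of degree `1` and `t` is
a divided powers variable of degree `2`: the free `Q`-module with basis
`y_{2i} = t^(i)`, `y_{2i+1} = t^(i) y`, for `i ≥ 0`. -/
def TateAlgebra (Q : Type u) [CommRing Q] : Type u := ℕ →₀ Q

/-- The structure constants: `y_i y_j = α_{i,j} y_{i+j}`. They say that `y * y = 0` and
`t^(i) * t^(j) = (i+j)!/(i! j!) t^(i+j)`. -/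
def alpha (i j : ℕ) : ℕ := if Odd i ∧ Odd j then 0 else ((i + j) / 2).choose (i / 2)

theorem alpha_comm (i j : ℕ) : alpha i j = alpha j i := by
  by_cases h : Odd i ∧ Odd j
  · rw [alpha, alpha, if_pos h, if_pos h.symm]
  · rw [alpha, alpha, if_neg h, if_neg (fun h' => h h'.symm)]
    rw [not_and_or, Nat.not_odd_iff_even, Nat.not_odd_iff_even, Nat.even_iff, Nat.even_iff] at h
    have e1 : (i + j) / 2 = i / 2 + j / 2 := by omega
    have e2 : (j + i) / 2 = i / 2 + j / 2 := by omega
    rw [e1, e2, Nat.choose_symm_add]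

theorem alpha_zero_left (j : ℕ) : alpha 0 j = 1 := by simp [alpha]

theorem choose_assoc (a b c : ℕ) :
    (a + b).choose a * (a + b + c).choose (a + b) =
      (b + c).choose b * (a + b + c).choose a := by
  have := Nat.choose_mul (n := a + b + c) (k := a + b) (s := a) (by omega)
  have e1 : a + b + c - a = b + c := by omega
  have e2 : a + b - a = b := by omega
  rw [e1, e2] at this
  rw [mul_comm, this, mul_comm]

theorem alpha_assoc (i j k : ℕ) :
    alpha i j * alpha (i + j) k = alpha j k * alpha i (j + k) := by
  obtain ⟨a, rfl | rfl⟩ := Nat.even_or_odd' i <;> obtain ⟨b, rfl | rfl⟩ := Nat.even_or_odd' j <;>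
    obtain ⟨c, rfl | rfl⟩ := Nat.even_or_odd' k <;>
    simp only [alpha, Nat.odd_iff]
  all_goals
    split_ifs <;> first | omega | skip
  all_goals
    convert choose_assoc a b c using 3 <;> omega

namespace TateAlgebra

variable {Q : Type u} [CommRing Q]

instance : AddCommGroup (TateAlgebra Q) := inferInstanceAs (AddCommGroup (ℕ →₀ Q))

instance : Module Q (TateAlgebra Q) := inferInstanceAs (Module Q (ℕ →₀ Q))

/-- The basis `y_0, y_1, y_2, …` of the Tate construction. -/
def yBasis (Q : Type u) [CommRing Q] : Module.Basis ℕ Q (TateAlgebra Q) :=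
  Module.Basis.ofRepr (LinearEquiv.refl Q (ℕ →₀ Q))

/-- The basis element `y_n`, of degree `n`. -/
def y (Q : Type u) [CommRing Q] (n : ℕ) : TateAlgebra Q := yBasis Q n

/-- The multiplication as a bilinear map. -/
def mulBilin (Q : Type u) [CommRing Q] :
    TateAlgebra Q →ₗ[Q] TateAlgebra Q →ₗ[Q] TateAlgebra Q :=
  (yBasis Q).constr Q fun i => (yBasis Q).constr Q fun j => (alpha i j : Q) • y Q (i + j)

instance : Mul (TateAlgebra Q) := ⟨fun a b => mulBilin Q a b⟩

instance : One (TateAlgebra Q) := ⟨y Q 0⟩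

theorem mul_def (a b : TateAlgebra Q) : a * b = mulBilin Q a b := rfl

theorem one_def : (1 : TateAlgebra Q) = y Q 0 := rfl

theorem mulBilin_y (i j : ℕ) : mulBilin Q (y Q i) (y Q j) = (alpha i j : Q) • y Q (i + j) := by
  simp [mulBilin, y]

theorem mulBilin_comm (a b : TateAlgebra Q) : mulBilin Q a b = mulBilin Q b a := by
  have h : mulBilin Q = (mulBilin Q).flip := by
    refine (yBasis Q).ext fun i => (yBasis Q).ext fun j => ?_
    have h1 := mulBilin_y (Q := Q) i j
    have h2 := mulBilin_y (Q := Q) j i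
    rw [LinearMap.flip_apply]
    refine h1.trans (Eq.trans ?_ h2.symm)
    rw [alpha_comm, add_comm]
  exact LinearMap.congr_fun₂ h a b

theorem mulBilin_one (b : TateAlgebra Q) : mulBilin Q (y Q 0) b = b := by
  have h : mulBilin Q (y Q 0) = LinearMap.id := by
    refine (yBasis Q).ext fun j => (mulBilin_y (Q := Q) 0 j).trans ?_
    simp [alpha_zero_left, y]
  exact LinearMap.congr_fun h b

theorem mulBilin_assoc (a b c : TateAlgebra Q) :
    mulBilin Q (mulBilin Q a b) c = mulBilin Q a (mulBilin Q b c) := by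
  have h : (LinearMap.llcomp Q _ _ _ (mulBilin Q)).comp (mulBilin Q) =
      (LinearMap.llcomp Q _ _ _).flip (mulBilin Q) ∘ₗ
        ((LinearMap.llcomp Q (TateAlgebra Q) (TateAlgebra Q) (TateAlgebra Q)) ∘ₗ mulBilin Q) := by
    refine (yBasis Q).ext fun i => (yBasis Q).ext fun j => (yBasis Q).ext fun k => ?_
    change mulBilin Q (mulBilin Q (y Q i) (y Q j)) (y Q k) =
      mulBilin Q (y Q i) (mulBilin Q (y Q j) (y Q k))
    simp only [mulBilin_y, map_smul, LinearMap.smul_apply, smul_smul]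
    rw [add_assoc, ← Nat.cast_mul, ← Nat.cast_mul, alpha_assoc]
  exact LinearMap.congr_fun (LinearMap.congr_fun₂ h a b) c

instance : CommRing (TateAlgebra Q) where
  __ := (inferInstance : AddCommGroup (TateAlgebra Q))
  mul_assoc := mulBilin_assoc
  one_mul := mulBilin_one
  mul_one a := (mulBilin_comm a (y Q 0)).trans (mulBilin_one a)
  mul_comm := mulBilin_comm
  left_distrib a b c := map_add (mulBilin Q a) b c
  right_distrib a b c := LinearMap.map_add₂ (mulBilin Q) a b c
  zero_mul a := LinearMap.map_zero₂ (mulBilin Q) a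
  mul_zero a := map_zero (mulBilin Q a)

instance : Algebra Q (TateAlgebra Q) :=
  Algebra.ofModule (fun r a b => LinearMap.map_smul₂ (mulBilin Q) r a b)
    (fun r a b => map_smul (mulBilin Q a) r b)

theorem y_mul_y (i j : ℕ) : y Q i * y Q j = (alpha i j : Q) • y Q (i + j) := mulBilin_y i j

/-- The degree `n` part `Q y_n` of the Tate construction. -/
def grading (Q : Type u) [CommRing Q] (n : ℕ) : Submodule Q (TateAlgebra Q) :=
  Submodule.span Q {y Q n}

/-- `f_i` is `f` for odd `i` and `g` for even `i`. -/
def coeff (f g : Q) (i : ℕ) : Q := if Odd i then f else g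

/-- The differential of the Tate construction: `∂ y_0 = 0` and `∂ y_i = f_i y_{i-1}` for `i ≥ 1`.
In other words `∂ t^(i) = g y t^(i-1)` and `∂ (y t^(i)) = f t^(i)`. -/
def diff (f g : Q) : TateAlgebra Q →ₗ[Q] TateAlgebra Q :=
  (yBasis Q).constr Q fun i => if i = 0 then 0 else coeff f g i • y Q (i - 1)

theorem diff_y_zero (f g : Q) : diff f g (y Q 0) = 0 := by
  simp [diff, y]

theorem diff_y_succ (f g : Q) (i : ℕ) :
    diff f g (y Q (i + 1)) = coeff f g (i + 1) • y Q i := by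
  simp [diff, y]

theorem alpha_leibniz (f g : Q) (i j : ℕ) :
    (alpha i (j + 1) : Q) * coeff f g (i + 1) + (-1) ^ (i + 1) * (alpha (i + 1) j * coeff f g (j + 1))
      = alpha (i + 1) (j + 1) * coeff f g (i + 1 + (j + 1)) := by
  obtain ⟨a, rfl | rfl⟩ := Nat.even_or_odd' i <;> obtain ⟨b, rfl | rfl⟩ := Nat.even_or_odd' j
  · have e1 : (2 * a + (2 * b + 1)) / 2 = a + b := by omega
    have e2 : (2 * a + 1 + 2 * b) / 2 = a + b := by omega
    have e3 : (2 * a + 1) / 2 = a := by omega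
    simp [alpha, coeff, e1, e2, e3, pow_succ, Nat.odd_iff, Nat.add_mod]
  · have e1 : (2 * a + (2 * b + 1 + 1)) / 2 = a + b + 1 := by omega
    have e2 : (2 * a + 1 + (2 * b + 1 + 1)) / 2 = a + b + 1 := by omega
    have e3 : (2 * a + 1) / 2 = a := by omega
    simp [alpha, coeff, e1, e2, e3, Nat.odd_iff, Nat.add_mod]
  · have e1 : (2 * a + 1 + 1 + 2 * b) / 2 = a + b + 1 := by omega
    have e2 : (2 * a + 1 + 1 + (2 * b + 1)) / 2 = a + b + 1 := by omega
    have e3 : (2 * a + 1 + 1) / 2 = a + 1 := by omega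
    simp [alpha, coeff, e1, e2, e3, pow_succ, Nat.odd_iff, Nat.add_mod]
  · have e1 : (2 * a + 1 + (2 * b + 1 + 1)) / 2 = a + b + 1 := by omega
    have e2 : (2 * a + 1 + 1 + (2 * b + 1)) / 2 = a + b + 1 := by omega
    have e3 : (2 * a + 1 + 1) / 2 = a + 1 := by omega
    have e4 : (2 * a + 1) / 2 = a := by omega
    have e5 : (2 * a + 1 + 1 + (2 * b + 1 + 1)) / 2 = a + b + 1 + 1 := by omega
    simp [alpha, coeff, e1, e2, e3, e4, e5, pow_succ, Nat.odd_iff, Nat.add_mod,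
      Nat.choose_succ_succ (a + b + 1) a]
    ring

theorem isDGAlgebra {f g : Q} (hfg : f * g = 0) : IsDGAlgebra (grading Q) (diff f g) where
  isInternal := by
    rw [DirectSum.isInternal_submodule_iff_iSupIndep_and_iSup_eq_top]
    refine ⟨(yBasis Q).linearIndependent.iSupIndep_span_singleton, ?_⟩
    have := (yBasis Q).span_eq
    rw [← Set.iUnion_singleton_eq_range, Submodule.span_iUnion] at this
    exact this
  gradedMonoid :=
    { one_mem := Submodule.subset_span rfl
      mul_mem := by
        intro i j a b ha hb
        obtain ⟨p, rfl⟩ := Submodule.mem_span_singleton.1 ha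
        obtain ⟨q, rfl⟩ := Submodule.mem_span_singleton.1 hb
        rw [smul_mul_smul_comm, y_mul_y, smul_smul]
        exact Submodule.smul_mem _ _ (Submodule.subset_span rfl) }
  mul_comm_sign := by
    intro i j a b ha hb
    obtain ⟨p, rfl⟩ := Submodule.mem_span_singleton.1 ha
    obtain ⟨q, rfl⟩ := Submodule.mem_span_singleton.1 hb
    by_cases h : Odd i ∧ Odd j
    · simp [y_mul_y, alpha, h]
    · have : Even (i * j) := by
        rw [← Nat.not_odd_iff_even, Nat.odd_mul]; exact h
      rw [this.neg_one_pow, one_mul, mul_comm]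
  sq_odd := by
    intro i a hi ha
    obtain ⟨p, rfl⟩ := Submodule.mem_span_singleton.1 ha
    simp [y_mul_y, alpha, hi]
  d_zero := by
    intro a ha
    obtain ⟨p, rfl⟩ := Submodule.mem_span_singleton.1 ha
    rw [map_smul, diff_y_zero, smul_zero]
  d_mem := by
    intro i a ha
    obtain ⟨p, rfl⟩ := Submodule.mem_span_singleton.1 ha
    rw [map_smul, diff_y_succ, smul_smul]
    exact Submodule.smul_mem _ _ (Submodule.subset_span rfl)
  d_d := by
    intro a
    have h : (diff f g).comp (diff f g) = 0 := by
      refine (yBasis Q).ext fun n => ?_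
      change diff f g (diff f g (y Q n)) = 0
      rcases n with _ | _ | n
      · rw [diff_y_zero, map_zero]
      · rw [diff_y_succ, map_smul, diff_y_zero, smul_zero]
      · rw [diff_y_succ, map_smul, diff_y_succ, smul_smul]
        have : coeff f g (n + 1 + 1) * coeff f g (n + 1) = 0 := by
          unfold coeff
          by_cases h : Odd (n + 1)
          · have h' : ¬ Odd (n + 1 + 1) := by
              rw [Nat.not_odd_iff_even]; exact h.add_one
            rw [if_pos h, if_neg h', mul_comm, hfg]
          · have h' : Odd (n + 1 + 1) := (Nat.not_odd_iff_even.1 h).add_one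
            rw [if_neg h, if_pos h', hfg]
        rw [this, zero_smul]
    exact LinearMap.congr_fun h a
  leibniz := by
    intro i a ha b
    obtain ⟨p, rfl⟩ := Submodule.mem_span_singleton.1 ha
    have key : ∀ j, diff f g (y Q i * y Q j) =
        diff f g (y Q i) * y Q j + (-1) ^ i * (y Q i * diff f g (y Q j)) := by
      intro j
      have hs : ∀ (n : ℕ) (x : TateAlgebra Q), (-1) ^ n * x = ((-1 : Q) ^ n) • x := by
        intro n x
        rcases Nat.even_or_odd n with h | h <;> simp [h.neg_one_pow]
      rcases i with _ | i
      · rw [diff_y_zero, ← one_def]; simp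
      rcases j with _ | j
      · rw [diff_y_zero, ← one_def]; simp
      rw [hs, y_mul_y, map_smul, ← add_assoc, diff_y_succ, diff_y_succ, diff_y_succ,
        smul_mul_assoc, mul_smul_comm, y_mul_y, y_mul_y, ← add_assoc, add_right_comm i 1 j]
      simp only [smul_smul]
      rw [← add_smul]
      congr 1
      have := alpha_leibniz f g i j
      rw [add_right_comm i 1 (j + 1), ← add_assoc] at this
      rw [← this]; ring
    have h : (diff f g).comp (LinearMap.mulLeft Q (y Q i)) =
        LinearMap.mulLeft Q (diff f g (y Q i)) +
          (LinearMap.mulLeft Q ((-1) ^ i * y Q i)).comp (diff f g) := by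
      refine (yBasis Q).ext fun j => ?_
      simp only [LinearMap.comp_apply, LinearMap.add_apply, LinearMap.mulLeft_apply, mul_assoc]
      exact key j
    have hb := LinearMap.congr_fun h b
    simp only [LinearMap.comp_apply, LinearMap.add_apply, LinearMap.mulLeft_apply] at hb
    rw [smul_mul_assoc, map_smul, hb, map_smul, smul_add, smul_mul_assoc, smul_mul_assoc,
      mul_smul_comm, mul_assoc]

/-- The coefficient of `y_0`, as a homomorphism of `Q`-algebras. -/
def coeffZero (Q : Type u) [CommRing Q] : TateAlgebra Q →ₐ[Q] Q :=
  AlgHom.ofLinearMap ((yBasis Q).constr Q fun i => if i = 0 then (1 : Q) else 0)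
    (by rw [one_def]; simp [y])
    (by
      intro a b
      set φ := (yBasis Q).constr Q fun i => if i = 0 then (1 : Q) else 0 with hφ
      have hy : ∀ i, φ (y Q i) = if i = 0 then (1 : Q) else 0 := by
        intro i; simp [hφ, y]
      have h : (mulBilin Q).compr₂ φ = (LinearMap.mul Q Q).compl₁₂ φ φ := by
        refine (yBasis Q).ext fun i => (yBasis Q).ext fun j => ?_
        change φ (mulBilin Q (y Q i) (y Q j)) = φ (y Q i) * φ (y Q j)
        rw [mulBilin_y, map_smul, hy, hy, hy]
        by_cases hi : i = 0
        · subst hi; simp [alpha_zero_left]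
        · simp [hi]
      exact LinearMap.congr_fun₂ h a b)

theorem coeffZero_y (i : ℕ) : coeffZero Q (y Q i) = if i = 0 then 1 else 0 := by
  simp [coeffZero, y]

/-- The augmentation `A → A_0 = Q → Q/I`. For `I = (f)` it is the canonical map
`A → H_0(A) = Q/(f)`. -/
def augmentation (I : Ideal Q) : TateAlgebra Q →ₐ[Q] Q ⧸ I :=
  (Ideal.Quotient.mkₐ Q I).comp (coeffZero Q)

/-- The quotient `Q/I` is an algebra over the Tate construction through the augmentation. -/
instance (I : Ideal Q) : Algebra (TateAlgebra Q) (Q ⧸ I) := (augmentation I).toAlgebra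

theorem smul_quot_def {I : Ideal Q} (a : TateAlgebra Q) (r : Q ⧸ I) :
    a • r = augmentation I a * r := rfl

theorem augmentation_y (I : Ideal Q) (i : ℕ) :
    augmentation I (y Q i) = if i = 0 then 1 else 0 := by
  simp only [augmentation, AlgHom.comp_apply, coeffZero_y]
  split_ifs <;> simp

theorem augmentation_diff (f g : Q) (a : TateAlgebra Q) :
    augmentation (Ideal.span {f}) (diff f g a) = 0 := by
  have h : (augmentation (Ideal.span {f})).toLinearMap.comp (diff f g) = 0 := by
    refine (yBasis Q).ext fun n => ?_
    change augmentation (Ideal.span {f}) (diff f g (y Q n)) = 0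
    rcases n with _ | n
    · rw [diff_y_zero, map_zero]
    · rw [diff_y_succ, map_smul, augmentation_y]
      rcases n with _ | n
      · rw [if_pos rfl, Algebra.smul_def, mul_one]
        have : coeff f g (0 + 1) = f := by simp [coeff]
        rw [this]
        exact Ideal.Quotient.eq_zero_iff_mem.2 (Ideal.mem_span_singleton_self f)
      · simp
  exact LinearMap.congr_fun h a

end TateAlgebra

/-! ### The complex `U ⊗_A R` for a dg module `U` over the Tate construction `A`, `R = Q/(f)`

The base change is written `R ⊗[A] U^#`, with its `R`-module structure on the left; since `R` is
concentrated in degree zero, its differential is `r ⊗ x ↦ r ⊗ ∂x`. -/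

section BaseChange

open TateAlgebra

variable {Q : Type u} [CommRing Q] {f g : Q} {U : ChainComplex (ModuleCat.{v} Q) ℕ}
  [Module (TateAlgebra Q) (Total U)]

/-- The module underlying `U ⊗_A R`. -/
abbrev BaseChange (f : Q) (U : ChainComplex (ModuleCat.{v} Q) ℕ)
    [Module (TateAlgebra Q) (Total U)] : Type (max u v) :=
  (Q ⧸ Ideal.span {f}) ⊗[TateAlgebra Q] Total U

theorem smul_tmul_totalD (h : IsDGModule (grading Q) (diff f g) U) (a : TateAlgebra Q)
    (r : Q ⧸ Ideal.span {f}) (x : Total U) :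
    (a • r) ⊗ₜ[TateAlgebra Q] totalD U x = r ⊗ₜ[TateAlgebra Q] totalD U (a • x) := by
  have := h.isScalarTower
  have ha : a ∈ Submodule.span Q (Set.range (yBasis Q)) := by
    rw [(yBasis Q).span_eq]; trivial
  induction ha using Submodule.span_induction with
  | zero => rw [zero_smul, zero_smul, map_zero, TensorProduct.zero_tmul, TensorProduct.tmul_zero]
  | add a b _ _ ha hb =>
    rw [add_smul, add_smul, TensorProduct.add_tmul, ha, hb, map_add, TensorProduct.tmul_add]
  | smul q a _ ha =>
    rw [smul_assoc q a x, map_smul, smul_assoc, ← algebraMap_smul (TateAlgebra Q) q (a • r),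
      ← algebraMap_smul (TateAlgebra Q) q (totalD U (a • x)), TensorProduct.tmul_smul,
      ← ha, TensorProduct.smul_tmul']
  | mem a ha =>
    obtain ⟨n, rfl⟩ := ha
    change (y Q n • r) ⊗ₜ[TateAlgebra Q] totalD U x = r ⊗ₜ[TateAlgebra Q] totalD U (y Q n • x)
    have hq : y Q n ∈ grading Q n := Submodule.subset_span rfl
    rw [h.leibniz hq, TensorProduct.tmul_add, ← TensorProduct.smul_tmul,
      smul_quot_def (diff f g (y Q n)), augmentation_diff, zero_mul, TensorProduct.zero_tmul, zero_add]
    rcases n with _ | n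
    · rw [pow_zero, one_smul, TensorProduct.smul_tmul]
    · have hz : y Q (n + 1) • r = 0 := by
        rw [smul_quot_def, augmentation_y, if_neg (Nat.succ_ne_zero n), zero_mul]
      rw [TensorProduct.tmul_smul, ← TensorProduct.smul_tmul, hz, TensorProduct.zero_tmul,
        smul_zero]

/-- The differential of `U ⊗_A R` as an additive map. -/
def baseChangeDAdd (h : IsDGModule (grading Q) (diff f g) U) : BaseChange f U →+ BaseChange f U :=
  TensorProduct.liftAddHom
    (AddMonoidHom.mk' (fun r : Q ⧸ Ideal.span {f} =>
      AddMonoidHom.mk' (fun x : Total U => (r ⊗ₜ[TateAlgebra Q] totalD U x : BaseChange f U))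
        (fun x x' => by rw [map_add, TensorProduct.tmul_add]))
      (fun r r' => AddMonoidHom.ext fun x => TensorProduct.add_tmul r r' (totalD U x)))
    (fun a r x => smul_tmul_totalD h a r x)

/-- The differential `r ⊗ x ↦ r ⊗ ∂x` of `U ⊗_A R`. -/
def baseChangeD (h : IsDGModule (grading Q) (diff f g) U) :
    BaseChange f U →ₗ[Q ⧸ Ideal.span {f}] BaseChange f U where
  toFun := baseChangeDAdd h
  map_add' := map_add _
  map_smul' s z := by
    induction z using TensorProduct.induction_on with
    | zero => rw [smul_zero, map_zero, smul_zero]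
    | tmul r x => rfl
    | add z z' hz hz' => rw [smul_add, map_add, hz, hz', map_add, smul_add]

theorem baseChangeD_tmul (h : IsDGModule (grading Q) (diff f g) U) (r : Q ⧸ Ideal.span {f})
    (x : Total U) : baseChangeD h (r ⊗ₜ x) = r ⊗ₜ totalD U x := rfl

/-- The degree `n` part of `U ⊗_A R`, generated by the elements `1 ⊗ x` with `x ∈ U_n`. -/
def baseChangeDeg (f : Q) (U : ChainComplex (ModuleCat.{v} Q) ℕ)
    [Module (TateAlgebra Q) (Total U)] (n : ℕ) :
    Submodule (Q ⧸ Ideal.span {f}) (BaseChange f U) :=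
  Submodule.span _ (Set.range fun x : U.X n =>
    (1 : Q ⧸ Ideal.span {f}) ⊗ₜ[TateAlgebra Q] DirectSum.lof Q ℕ (fun n => U.X n) n x)

theorem baseChangeD_mem (h : IsDGModule (grading Q) (diff f g) U) (n : ℕ)
    (z : BaseChange f U) (hz : z ∈ baseChangeDeg f U (n + 1)) :
    baseChangeD h z ∈ baseChangeDeg f U n := by
  suffices baseChangeDeg f U (n + 1) ≤ (baseChangeDeg f U n).comap (baseChangeD h) from this hz
  refine Submodule.span_le.2 ?_
  rintro _ ⟨x, rfl⟩
  change baseChangeD h _ ∈ baseChangeDeg f U n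
  rw [baseChangeD_tmul, totalD_lof_succ]
  exact Submodule.subset_span ⟨_, rfl⟩

theorem baseChangeD_baseChangeD (h : IsDGModule (grading Q) (diff f g) U) (z : BaseChange f U) :
    baseChangeD h (baseChangeD h z) = 0 := by
  induction z using TensorProduct.induction_on with
  | zero => simp
  | tmul r x => rw [baseChangeD_tmul, baseChangeD_tmul, totalD_totalD, TensorProduct.tmul_zero]
  | add z z' hz hz' => rw [map_add, map_add, hz, hz', add_zero]

/-- The complex `U ⊗_A R` of `R`-modules. -/
def baseChangeComplex (h : IsDGModule (grading Q) (diff f g) U) :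
    ChainComplex (ModuleCat.{max u v} (Q ⧸ Ideal.span {f})) ℕ :=
  ChainComplex.of (fun n => ModuleCat.of (Q ⧸ Ideal.span {f}) (baseChangeDeg f U n))
    (fun n => ModuleCat.ofHom ((baseChangeD h).restrict (baseChangeD_mem h n)))
    (fun _ => ModuleCat.hom_ext (LinearMap.ext fun z =>
      Subtype.ext (baseChangeD_baseChangeD h z.1)))

/-- The map `U_n → (U ⊗_A R)_n`, `x ↦ x ⊗ 1`. -/
def toBaseChange (h : IsDGModule (grading Q) (diff f g) U) (n : ℕ) (x : U.X n) :
    (baseChangeComplex h).X n :=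
  (⟨1 ⊗ₜ DirectSum.lof Q ℕ (fun n => U.X n) n x, Submodule.subset_span ⟨x, rfl⟩⟩ :
    baseChangeDeg f U n)

end BaseChange

theorem isLocalRing_quotient {Q : Type u} [CommRing Q] [IsLocalRing Q] {f : Q}
    (hf : f ∈ IsLocalRing.maximalIdeal Q) : IsLocalRing (Q ⧸ Ideal.span {f}) := by
  have : Nontrivial (Q ⧸ Ideal.span {f}) := Ideal.Quotient.nontrivial_iff.2 (by
    rw [Ne, Ideal.span_singleton_eq_top]
    exact hf)
  exact IsLocalRing.of_surjective' (Ideal.Quotient.mk _) Ideal.Quotient.mk_surjective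

end DGTate

end

/-! Part (a). The generators over A are found degree by degree. They span a free A-module F with
differential D and a comparison map `eval` to the total module of U, arranged to commute with the
differentials and to be bijective in each degree already treated. In degree n the old generators
contribute the elements y_i e_s with i ≥ 1. These have to map to part of a basis of U_n, and over a
local ring it suffices that `eval` be injective modulo 𝔫 on their span N. If `eval x` lies in 𝔫U_n,
minimality puts its boundary in 𝔫²U_{n-1}, so Dx is in 𝔫²F. The coefficient of y_i e_s in Dx is f or
g times the coefficient of y_{i+1} e_s in x, plus terms from generators e_t of larger degree, which
are in 𝔫² by descending induction on the degree. Since f and g are not in 𝔫², x lies in 𝔫F. This is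
`repr_mem_maximalIdeal_of_freeD` and `mem_smul_of_eval_mem`.

A basis of a complement of N in U_n gives the new generators. Their boundaries lift to F by
`exists_differential`; the images of the y_i e_s are chosen by exactness of U in `exists_lifts`,
where fg = 0 makes the prescribed boundaries cycles and fM = 0 handles degree 0. The A-module
structure is then transported along `eval`. Generators are indexed by all pairs (degree, number),
those with number at least the rank being ignored, so that no type changes while the construction
proceeds.

Part (b). For exact zero divisors the kernel of A → R is acyclic (`exists_diff_eq`). Filtering U by
the degree of the basis elements, with subquotients sums of shifts of A, shows that the kernel of U
→ U ⊗_A R is acyclic (`exists_totalD_eq`). Hence cycles of U ⊗_A R in positive degrees lift to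
cycles of U. In degree 0 the kernel lies in fU_0, which ε kills, so ε descends. -/

noncomputable section

namespace DGTate

open TateAlgebra

/-! ### Free modules over the Tate construction -/

section FreeModule

variable {Q : Type u} [CommRing Q] {σ : Type*} {T : Type*} [AddCommGroup T] [Module Q T]

/-- The `Q`-basis `y_i e_s` of the free `A`-module with basis `(e_s)`. -/
def freeBasis (Q : Type u) [CommRing Q] (σ : Type*) :
    Module.Basis (Σ _ : σ, ℕ) Q (σ →₀ TateAlgebra Q) :=
  Finsupp.basis fun _ => yBasis Q

theorem freeBasis_apply (p : Σ _ : σ, ℕ) :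
    freeBasis Q σ p = Finsupp.single p.1 (y Q p.2) := by
  rw [freeBasis, Finsupp.coe_basis]; rfl

theorem freeBasis_repr_apply (x : σ →₀ TateAlgebra Q) (p : Σ _ : σ, ℕ) :
    (freeBasis Q σ).repr x p = (yBasis Q).repr (x p.1) p.2 := rfl

/-- The involution `a ↦ (-1)^|a| a` of the Tate construction. -/
def signMap (Q : Type u) [CommRing Q] : TateAlgebra Q →ₗ[Q] TateAlgebra Q :=
  (yBasis Q).constr Q fun i => (-1 : Q) ^ i • y Q i

theorem signMap_y (i : ℕ) : signMap Q (y Q i) = (-1 : Q) ^ i • y Q i := by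
  simp [signMap, y]

theorem signMap_mul {i : ℕ} {a : TateAlgebra Q} (ha : a ∈ grading Q i) (b : TateAlgebra Q) :
    signMap Q (a * b) = (-1 : Q) ^ i • (a * signMap Q b) := by
  obtain ⟨p, rfl⟩ := Submodule.mem_span_singleton.1 ha
  have h : (signMap Q).comp (LinearMap.mulLeft Q (y Q i)) =
      (-1 : Q) ^ i • (LinearMap.mulLeft Q (y Q i)).comp (signMap Q) := by
    refine (yBasis Q).ext fun j => ?_
    change signMap Q (y Q i * y Q j) = (-1 : Q) ^ i • (y Q i * signMap Q (y Q j))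
    rw [signMap_y, y_mul_y, map_smul, signMap_y, mul_smul_comm, y_mul_y]
    simp only [smul_smul]
    congr 1
    ring
  have := LinearMap.congr_fun h b
  simp only [LinearMap.comp_apply, LinearMap.smul_apply, LinearMap.mulLeft_apply] at this
  rw [smul_mul_assoc, map_smul, this, smul_mul_assoc, smul_comm]

/-- The differential on the free `A`-module with basis `(e_s)` that satisfies the Leibniz formula
and `∂ e_s = δ s`. -/
def freeD (f g : Q) (δ : σ → σ →₀ TateAlgebra Q) :
    (σ →₀ TateAlgebra Q) →ₗ[Q] (σ →₀ TateAlgebra Q) :=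
  Finsupp.lsum Q fun s => (Finsupp.lsingle s).comp (diff f g) +
    ((LinearMap.toSpanSingleton (TateAlgebra Q) (σ →₀ TateAlgebra Q)
      (δ s)).restrictScalars Q).comp (signMap Q)

theorem freeD_single (f g : Q) (δ : σ → σ →₀ TateAlgebra Q) (s : σ) (a : TateAlgebra Q) :
    freeD f g δ (Finsupp.single s a) = Finsupp.single s (diff f g a) + signMap Q a • δ s := by
  rw [freeD, Finsupp.lsum_single]; rfl

theorem freeD_single_y (f g : Q) (δ : σ → σ →₀ TateAlgebra Q) (s : σ) (i : ℕ) :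
    freeD f g δ (Finsupp.single s (y Q i)) =
      Finsupp.single s (diff f g (y Q i)) + (-1 : Q) ^ i • y Q i • δ s := by
  rw [freeD_single, signMap_y, smul_assoc]

theorem freeD_single_y_succ (f g : Q) (δ : σ → σ →₀ TateAlgebra Q) (s : σ) (i : ℕ) :
    freeD f g δ (Finsupp.single s (y Q (i + 1))) =
      coeff f g (i + 1) • Finsupp.single s (y Q i) + (-1 : Q) ^ (i + 1) • y Q (i + 1) • δ s := by
  rw [freeD_single_y, diff_y_succ, Finsupp.smul_single]

theorem freeD_single_y_zero (f g : Q) (δ : σ → σ →₀ TateAlgebra Q) (s : σ) :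
    freeD f g δ (Finsupp.single s (y Q 0)) = δ s := by
  rw [freeD_single_y, diff_y_zero, Finsupp.single_zero, zero_add, pow_zero, one_smul, ← one_def,
    one_smul]

/-- On each generator this is the Leibniz formula of A. The choice of `δ` plays no role; only D² = 0
would constrain it. -/
theorem freeD_smul {f g : Q} (hfg : f * g = 0) (δ : σ → σ →₀ TateAlgebra Q) {i : ℕ}
    {a : TateAlgebra Q} (ha : a ∈ grading Q i) (x : σ →₀ TateAlgebra Q) :
    freeD f g δ (a • x) = diff f g a • x + (-1 : Q) ^ i • a • freeD f g δ x := by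
  induction x using Finsupp.induction_linear with
  | zero => simp
  | add x x' hx hx' => rw [smul_add, map_add, hx, hx', map_add]; simp only [smul_add]; abel
  | single s b =>
    have hs : ((-1) ^ i * (a * diff f g b) : TateAlgebra Q) = (-1 : Q) ^ i • (a * diff f g b) := by
      rcases Nat.even_or_odd i with h | h <;> simp [h.neg_one_pow]
    rw [Finsupp.smul_single, smul_eq_mul, freeD_single, freeD_single,
      (isDGAlgebra hfg).leibniz ha b, signMap_mul ha, hs, Finsupp.smul_single, smul_eq_mul,
      smul_add, smul_add, Finsupp.single_add, Finsupp.smul_single, Finsupp.smul_single,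
      smul_eq_mul, smul_assoc, mul_smul, add_assoc]

theorem y_mem_grading (i : ℕ) : y Q i ∈ grading Q i := Submodule.subset_span rfl

/-- The `Q`-linear map with `y_i e_s ↦ B i s`. -/
def freeEval (B : ℕ → σ → T) : (σ →₀ TateAlgebra Q) →ₗ[Q] T :=
  Finsupp.lsum Q fun s => (yBasis Q).constr Q fun i => B i s

theorem freeEval_apply (B : ℕ → σ → T) (x : σ →₀ TateAlgebra Q) :
    freeEval B x = x.sum fun s a => (yBasis Q).constr Q (fun i => B i s) a := rfl

theorem freeEval_single (B : ℕ → σ → T) (s : σ) (i : ℕ) :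
    freeEval B (Finsupp.single s (y Q i)) = B i s := by
  rw [freeEval, Finsupp.lsum_single, y, Module.Basis.constr_basis]

/-- Locality: generators not occurring in x do not matter, so data in higher degrees can be altered
freely. -/
theorem freeEval_congr {B B' : ℕ → σ → T} {x : σ →₀ TateAlgebra Q}
    (h : ∀ s, x s ≠ 0 → ∀ i, B i s = B' i s) : freeEval B x = freeEval B' x := by
  rw [freeEval_apply, freeEval_apply]
  refine Finsupp.sum_congr fun s hs => ?_
  rw [funext (h s (Finsupp.mem_support_iff.1 hs))]

/-- The span of the `y_i e_s` with `(s, i)` in a given set. -/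
def freeSpan (Q : Type u) [CommRing Q] (S : Set (Σ _ : σ, ℕ)) :
    Submodule Q (σ →₀ TateAlgebra Q) :=
  Submodule.span Q (freeBasis Q σ '' S)

theorem mem_freeSpan {S : Set (Σ _ : σ, ℕ)} {x : σ →₀ TateAlgebra Q} :
    x ∈ freeSpan Q S ↔ ∀ p, (freeBasis Q σ).repr x p ≠ 0 → p ∈ S := by
  rw [freeSpan, Module.Basis.mem_span_image]
  exact ⟨fun h p hp => h (by simpa using hp), fun h p hp => h p (by simpa using hp)⟩

theorem single_mem_freeSpan {S : Set (Σ _ : σ, ℕ)} {s : σ} {i : ℕ} (h : ⟨s, i⟩ ∈ S) :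
    Finsupp.single s (y Q i) ∈ freeSpan Q S := by
  refine Submodule.subset_span ⟨_, h, ?_⟩
  rw [freeBasis_apply]

theorem freeSpan_le {S : Set (Σ _ : σ, ℕ)} {N : Submodule Q (σ →₀ TateAlgebra Q)} :
    freeSpan Q S ≤ N ↔ ∀ s i, (⟨s, i⟩ : Σ _ : σ, ℕ) ∈ S → Finsupp.single s (y Q i) ∈ N := by
  rw [freeSpan, Submodule.span_le]
  constructor
  · intro h s i hs
    have := h ⟨_, hs, rfl⟩
    rwa [freeBasis_apply] at this
  · rintro h _ ⟨⟨s, i⟩, hs, rfl⟩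
    rw [freeBasis_apply]
    exact h s i hs

theorem freeSpan_mono {S S' : Set (Σ _ : σ, ℕ)} (h : S ⊆ S') :
    freeSpan Q S ≤ freeSpan Q S' :=
  Submodule.span_mono (Set.image_mono h)

theorem freeSpan_free (S : Set (Σ _ : σ, ℕ)) : Module.Free Q (freeSpan Q S) := by
  have h : freeSpan Q S = Submodule.span Q (Set.range fun p : S => freeBasis Q σ p) := by
    rw [freeSpan, Set.image_eq_range]
  rw [h]
  exact Module.Free.of_basis (Module.Basis.span
    ((freeBasis Q σ).linearIndependent.comp _ Subtype.val_injective))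

theorem freeSpan_finite {S : Set (Σ _ : σ, ℕ)} (hS : S.Finite) :
    Module.Finite Q (freeSpan Q S) :=
  Module.Finite.span_of_finite Q (hS.image _)

theorem y_smul_mem_freeSpan {S S' : Set (Σ _ : σ, ℕ)} {k : ℕ}
    (h : ∀ s i, (⟨s, i⟩ : Σ _ : σ, ℕ) ∈ S → ⟨s, k + i⟩ ∈ S') {x : σ →₀ TateAlgebra Q}
    (hx : x ∈ freeSpan Q S) : y Q k • x ∈ freeSpan Q S' := by
  suffices freeSpan Q S ≤ (freeSpan Q S').comap (Algebra.lsmul Q Q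
    (σ →₀ TateAlgebra Q) (y Q k)) from this hx
  refine freeSpan_le.2 fun s i hs => ?_
  change y Q k • Finsupp.single s (y Q i) ∈ freeSpan Q S'
  rw [Finsupp.smul_single, smul_eq_mul, y_mul_y, ← Finsupp.smul_single]
  exact Submodule.smul_mem _ _ (single_mem_freeSpan (h s i hs))

theorem free_hom_ext {φ ψ : (σ →₀ TateAlgebra Q) →ₗ[Q] T}
    {S : Set (Σ _ : σ, ℕ)} (h : ∀ s i, (⟨s, i⟩ : Σ _ : σ, ℕ) ∈ S →
      φ (Finsupp.single s (y Q i)) = ψ (Finsupp.single s (y Q i))) {x : σ →₀ TateAlgebra Q}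
    (hx : x ∈ freeSpan Q S) : φ x = ψ x := by
  suffices freeSpan Q S ≤ LinearMap.eqLocus φ ψ from this hx
  exact freeSpan_le.2 h

theorem repr_mem_of_mem_smul_top {I : Ideal Q} {x : σ →₀ TateAlgebra Q}
    {N : Submodule Q (σ →₀ TateAlgebra Q)} (hx : x ∈ I • N) (p : Σ _ : σ, ℕ) :
    (freeBasis Q σ).repr x p ∈ I := by
  suffices I • N ≤ Submodule.comap ((freeBasis Q σ).coord p) I from this hx
  refine Submodule.smul_le.2 fun r hr n _ => ?_
  rw [Submodule.mem_comap, map_smul, smul_eq_mul]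
  exact Ideal.mul_mem_right _ _ hr

theorem y_smul_mem_smul_top {I : Ideal Q} {x : σ →₀ TateAlgebra Q}
    {N : Submodule Q (σ →₀ TateAlgebra Q)} (hx : x ∈ I • N) (k : ℕ) :
    y Q k • x ∈ I • (⊤ : Submodule Q (σ →₀ TateAlgebra Q)) := by
  have h := Submodule.mem_map_of_mem (f := Algebra.lsmul Q Q
    (σ →₀ TateAlgebra Q) (y Q k)) hx
  rw [Submodule.map_smul''] at h
  exact Submodule.smul_mono le_rfl le_top h

theorem mem_smul_freeSpan {I : Ideal Q} {S : Set (Σ _ : σ, ℕ)} {x : σ →₀ TateAlgebra Q}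
    (hx : x ∈ freeSpan Q S) (hI : ∀ p, (freeBasis Q σ).repr x p ∈ I) :
    x ∈ I • freeSpan Q S := by
  rw [← (freeBasis Q σ).linearCombination_repr x, Finsupp.linearCombination_apply]
  refine Submodule.sum_mem _ fun p hp => Submodule.smul_mem_smul (hI p) ?_
  exact Submodule.subset_span ⟨p, mem_freeSpan.1 hx p (Finsupp.mem_support_iff.1 hp), rfl⟩

end FreeModule

/-! ### Complements over a local ring, and recursive choice of sequences. -/

section Auxiliary

/-- A linear map between finite free modules over a local ring which is injective modulo the
maximal ideal extends, by a finite free complement, to an isomorphism. -/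
theorem exists_complement_of_injective_mod {Q : Type*} [CommRing Q] [IsLocalRing Q]
    {N M : Type*} [AddCommGroup N] [Module Q N] [AddCommGroup M] [Module Q M]
    [Module.Finite Q N] [Module.Free Q N] [Module.Finite Q M] [Module.Free Q M] (φ : N →ₗ[Q] M)
    (hφ : ∀ x, φ x ∈ IsLocalRing.maximalIdeal Q • (⊤ : Submodule Q M) →
      x ∈ IsLocalRing.maximalIdeal Q • (⊤ : Submodule Q N)) :
    ∃ (r : ℕ) (e : Fin r → M),
      (∀ (x : N) (c : Fin r → Q), φ x + ∑ s, c s • e s = 0 → x = 0 ∧ c = 0) ∧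
      ∀ m : M, ∃ (x : N) (c : Fin r → Q), φ x + ∑ s, c s • e s = m := by
  obtain ⟨π, hπ⟩ := (IsLocalRing.split_injective_iff_lTensor_residueField_injective φ).2 (by
    rw [injective_iff_map_eq_zero]
    intro z hz
    -- Since Q surjects onto the residue field k, every element of k ⊗ N is a pure tensor 1 ⊗ x; so
    -- injectivity after tensoring is exactly `hφ`.
    obtain ⟨x, rfl⟩ : ∃ x : N, z = 1 ⊗ₜ x := by
      have key : ∀ w : IsLocalRing.ResidueField Q ⊗[Q] N, ∃ x : N, w = 1 ⊗ₜ x := by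
        intro w
        induction w using TensorProduct.induction_on with
        | zero => exact ⟨0, by simp⟩
        | tmul a x =>
          obtain ⟨q, rfl⟩ := IsLocalRing.residue_surjective a
          refine ⟨q • x, ?_⟩
          rw [TensorProduct.tmul_smul, TensorProduct.smul_tmul']
          congr 1
          rw [Algebra.smul_def, mul_one]; rfl
        | add w w' hw hw' =>
          obtain ⟨x, rfl⟩ := hw
          obtain ⟨x', rfl⟩ := hw'
          exact ⟨x + x', (TensorProduct.tmul_add _ _ _).symm⟩
      exact key _
    have h1 := congrArg (TensorProduct.quotTensorEquivQuotSMul M (IsLocalRing.maximalIdeal Q)) hz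
    have e1 : (TensorProduct.quotTensorEquivQuotSMul M (IsLocalRing.maximalIdeal Q))
        (1 ⊗ₜ φ x) = Submodule.Quotient.mk (φ x) := by
      simp
    have e2 : (TensorProduct.quotTensorEquivQuotSMul N (IsLocalRing.maximalIdeal Q))
        (1 ⊗ₜ x) = Submodule.Quotient.mk x := by
      simp
    have h2 := (Submodule.Quotient.mk_eq_zero _).1 (e1.symm.trans (h1.trans (map_zero _)))
    refine (TensorProduct.quotTensorEquivQuotSMul N (IsLocalRing.maximalIdeal Q)).injective ?_
    exact (e2.trans ((Submodule.Quotient.mk_eq_zero _).2 (hφ x h2))).trans (map_zero _).symm)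
  have hπ' : ∀ x, π (φ x) = x := fun x => LinearMap.congr_fun hπ x
  -- The projection onto `ker π` along the image of φ. It makes `ker π` a direct summand of M, hence
  -- finite projective, hence free.
  let ρ : M →ₗ[Q] LinearMap.ker π := LinearMap.codRestrict _ (LinearMap.id - φ.comp π) (by
    intro m
    simp [hπ'])
  have hρ : ∀ m, ((ρ m : LinearMap.ker π) : M) = m - φ (π m) := fun m => rfl
  have hsurj : Function.Surjective ρ := fun k => ⟨k, Subtype.ext (by rw [hρ, k.2]; simp)⟩
  have : Module.Finite Q (LinearMap.ker π) := Module.Finite.of_surjective ρ hsurj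
  have : Module.Projective Q (LinearMap.ker π) :=
    Module.Projective.of_split (LinearMap.ker π).subtype ρ
      (LinearMap.ext fun k => Subtype.ext (by
        simp only [LinearMap.comp_apply, Submodule.subtype_apply, hρ]; rw [k.2]; simp))
  have : Module.Free Q (LinearMap.ker π) := Module.free_of_flat_of_isLocalRing
  let b := Module.finBasis Q (LinearMap.ker π)
  have hb : ∀ c : Fin _ → Q, ∑ s, c s • (b s : M) = ((∑ s, c s • b s : LinearMap.ker π) : M) := by
    intro c; simp
  refine ⟨_, fun s => (b s : M), fun x c h => ?_, fun m => ?_⟩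
  · rw [hb] at h
    have hx : x = 0 := by
      have := congrArg π h
      rwa [map_add, hπ', LinearMap.map_coe_ker, add_zero, map_zero] at this
    refine ⟨hx, ?_⟩
    rw [hx, map_zero, zero_add, Submodule.coe_eq_zero] at h
    exact funext fun s => Fintype.linearIndependent_iff.1 b.linearIndependent c h s
  · refine ⟨π m, fun s => b.repr (ρ m) s, ?_⟩
    rw [hb, b.sum_repr, hρ]
    abel

/-- The invariant `P` carries what makes the next choice possible; `R` is what is kept about
consecutive terms. -/
theorem exists_seq_of_step {T : Type*} (P : ℕ → T → Prop) (R : ℕ → T → T → Prop) {z : T}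
    (h0 : P 0 z) (hstep : ∀ i x, P i x → ∃ x', P (i + 1) x' ∧ R i x x') :
    ∃ b : ℕ → T, b 0 = z ∧ (∀ i, P i (b i)) ∧ ∀ i, R i (b i) (b (i + 1)) := by
  choose F hF hR using hstep
  let b : ∀ i, {x // P i x} := fun i => Nat.rec ⟨z, h0⟩ (fun i x => ⟨F i x.1 x.2, hF i x.1 x.2⟩) i
  exact ⟨fun i => (b i).1, rfl, fun i => (b i).2, fun i => hR i (b i).1 (b i).2⟩

/-- Stage n overwrites entry n of a whole sequence. By locality the conditions already achieved
survive later stages, and the diagonal of the stages satisfies all of them. -/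
theorem exists_seq_of_local {α : Type*} [Inhabited α] (P : (ℕ → α) → ℕ → Prop)
    (hlocal : ∀ (p p' : ℕ → α) (n : ℕ), (∀ m ≤ n, p m = p' m) → P p n → P p' n)
    (hstep : ∀ (p : ℕ → α) (n : ℕ), (∀ m < n, P p m) → ∃ x, P (Function.update p n x) n) :
    ∃ p : ℕ → α, ∀ n, P p n := by
  choose F hF using hstep
  classical
  -- The `else` branch only makes `G` total; `hq` shows that it is never taken.
  let G : ℕ → (ℕ → α) → (ℕ → α) := fun n p =>
    if h : ∀ m < n, P p m then Function.update p n (F p n h) else p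
  let q : ℕ → ℕ → α := fun k => Nat.rec (fun _ => default) (fun n p => G n p) k
  have hqs : ∀ n, q (n + 1) = G n (q n) := fun n => rfl
  have hq : ∀ n, ∀ m < n, P (q n) m := by
    intro n
    induction n with
    | zero => intro m hm; exact absurd hm (Nat.not_lt_zero _)
    | succ n ih =>
      intro m hm
      have e : q (n + 1) = Function.update (q n) n (F (q n) n ih) := by
        rw [hqs]; exact dif_pos ih
      rw [e]
      rcases Nat.lt_succ_iff_lt_or_eq.1 hm with h | rfl
      · exact hlocal _ _ m (fun k hk => (Function.update_of_ne (by omega) _ _).symm) (ih m h)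
      · exact hF _ _ _
  -- Entry m is final after stage m.
  have hstab : ∀ n k m, m < n → q (n + k) m = q n m := by
    intro n k m hm
    induction k with
    | zero => rfl
    | succ k ih =>
      rw [← ih, ← add_assoc, hqs]
      dsimp only [G]
      split_ifs
      · exact Function.update_of_ne (by omega) _ _
      · rfl
  refine ⟨fun n => q (n + 1) n, fun n => hlocal (q (n + 1)) _ n (fun m hm => ?_)
    (hq (n + 1) n (Nat.lt_succ_self n))⟩
  obtain ⟨k, rfl⟩ := Nat.exists_eq_add_of_le hm
  have := hstab (m + 1) k m (Nat.lt_succ_self m)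
  rwa [add_right_comm] at this

end Auxiliary

/-! ### The leading term argument, where f, g ∉ 𝔫² enters. -/

section LeadingTerm

variable {Q : Type u} [CommRing Q] [IsLocalRing Q] {σ : Type*}

/-- In a minimal semi-free dg module `F` over the Tate construction, an element `x` of the
ideal generated by the `y_i`, `i ≥ 1`, is in `𝔫 F` as soon as `∂ x` is in `𝔫² F`. -/
theorem repr_mem_maximalIdeal_of_freeD {f g : Q} (hf2 : f ∉ IsLocalRing.maximalIdeal Q ^ 2)
    (hg2 : g ∉ IsLocalRing.maximalIdeal Q ^ 2) (deg : σ → ℕ) (δ : σ → σ →₀ TateAlgebra Q) (n : ℕ)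
    (x : σ →₀ TateAlgebra Q)
    (hx : ∀ p, (freeBasis Q σ).repr x p ≠ 0 → p.2 ≠ 0 ∧ deg p.1 ≤ n)
    (hδ : ∀ s, x s ≠ 0 → ∀ k p, deg s ≤ deg p.1 → (freeBasis Q σ).repr (y Q k • δ s) p = 0)
    (hδI : ∀ s, x s ≠ 0 → ∀ k p,
      (freeBasis Q σ).repr (y Q k • δ s) p ∈ IsLocalRing.maximalIdeal Q)
    (hD : ∀ p, (freeBasis Q σ).repr (freeD f g δ x) p ∈ IsLocalRing.maximalIdeal Q ^ 2)
    (p : Σ _ : σ, ℕ) : (freeBasis Q σ).repr x p ∈ IsLocalRing.maximalIdeal Q := by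
  -- Descending induction on the degree of the generator, starting with the generators of largest
  -- degree.
  induction h : n - deg p.1 using Nat.strong_induction_on generalizing p with
  | _ N ih =>
    by_cases hp : (freeBasis Q σ).repr x p = 0
    · rw [hp]; exact zero_mem _
    obtain ⟨s, i⟩ := p
    have hxs : ∀ q : Σ _ : σ, ℕ, (freeBasis Q σ).repr x q ≠ 0 → x q.1 ≠ 0 := by
      intro q hq h0
      apply hq
      rw [freeBasis_repr_apply, h0, map_zero, Finsupp.zero_apply]
    obtain ⟨i, rfl⟩ := Nat.exists_eq_succ_of_ne_zero (hx _ hp).1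
    -- The coefficient of x at y_{i+1} e_s is read off from that of ∂x one step lower, at y_i e_s.
    have hsum : (freeBasis Q σ).repr (freeD f g δ x) ⟨s, i⟩ =
        ∑ q ∈ ((freeBasis Q σ).repr x).support, (freeBasis Q σ).repr x q *
          (freeBasis Q σ).repr (freeD f g δ (freeBasis Q σ q)) ⟨s, i⟩ := by
      conv_lhs => rw [← (freeBasis Q σ).linearCombination_repr x]
      rw [Finsupp.linearCombination_apply, Finsupp.sum, map_sum, map_sum, Finsupp.finsetSum_apply]
      refine Finset.sum_congr rfl fun q _ => ?_
      rw [map_smul, map_smul, Finsupp.smul_apply, smul_eq_mul]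
    classical
    rw [← Finset.add_sum_erase _ _ (Finsupp.mem_support_iff.2 hp)] at hsum
    have hrest : ∑ q ∈ ((freeBasis Q σ).repr x).support.erase ⟨s, i + 1⟩,
        (freeBasis Q σ).repr x q *
          (freeBasis Q σ).repr (freeD f g δ (freeBasis Q σ q)) ⟨s, i⟩ ∈
        IsLocalRing.maximalIdeal Q ^ 2 := by
      refine Submodule.sum_mem _ fun q hq => ?_
      obtain ⟨hq1, hq2⟩ := Finset.mem_erase.1 hq
      have hq3 := Finsupp.mem_support_iff.1 hq2
      obtain ⟨t, j⟩ := q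
      obtain ⟨j, rfl⟩ := Nat.exists_eq_succ_of_ne_zero (hx _ hq3).1
      have hne : (⟨t, j⟩ : Σ _ : σ, ℕ) ≠ ⟨s, i⟩ := by
        rintro h; cases h; exact hq1 rfl
      rw [freeBasis_apply, Nat.succ_eq_add_one, freeD_single_y_succ, map_add, Finsupp.add_apply,
        map_smul, map_smul, Finsupp.smul_apply, Finsupp.smul_apply]
      rw [← freeBasis_apply (Q := Q) (⟨t, j⟩ : Σ _ : σ, ℕ), Module.Basis.repr_self,
        Finsupp.single_eq_of_ne hne.symm, smul_zero, zero_add]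
      -- If deg t ≤ deg s, then ∂e_t has no component along e_s. Otherwise the coefficient of x is
      -- in 𝔫 by induction and that of y_{j+1} ∂e_t is in 𝔫, so the product is in 𝔫².
      by_cases hd : deg t ≤ deg s
      · rw [hδ t (hxs _ hq3) _ _ hd, smul_zero, mul_zero]; exact zero_mem _
      · rw [pow_two]
        refine Ideal.mul_mem_mul (ih _ ?_ _ rfl)
          (Ideal.mul_mem_left _ _ (hδI t (hxs _ hq3) _ _))
        have := (hx _ hp).2
        have := (hx _ hq3).2
        dsimp only at *
        omega
    have hcoeff : (freeBasis Q σ).repr (freeD f g δ (freeBasis Q σ ⟨s, i + 1⟩)) ⟨s, i⟩ =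
        coeff f g (i + 1) := by
      rw [freeBasis_apply, freeD_single_y_succ, map_add, Finsupp.add_apply,
        map_smul, map_smul, Finsupp.smul_apply, Finsupp.smul_apply,
        ← freeBasis_apply (Q := Q) (⟨s, i⟩ : Σ _ : σ, ℕ), Module.Basis.repr_self,
        Finsupp.single_eq_same, hδ s (hxs _ hp) _ _ le_rfl, smul_zero, add_zero, smul_eq_mul,
        mul_one]
    rw [hcoeff] at hsum
    have hmem : (freeBasis Q σ).repr x ⟨s, i + 1⟩ * coeff f g (i + 1) ∈
        IsLocalRing.maximalIdeal Q ^ 2 := by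
      rw [eq_sub_of_add_eq hsum.symm]
      exact sub_mem (hD _) hrest
    -- Were the coefficient a unit, f or g, according to the parity of i, would be in 𝔫².
    rw [IsLocalRing.mem_maximalIdeal, mem_nonunits_iff]
    intro hu
    have := (Ideal.unit_mul_mem_iff_mem _ hu).1 hmem
    unfold coeff at this
    split_ifs at this
    · exact hf2 this
    · exact hg2 this

end LeadingTerm

/-! ### Generators sorted by degree. -/

section GenData

variable {Q : Type u} [CommRing Q] {T : Type v}

/-- The generators of degree `n` of a semi-free dg module mapping to `T`: their number `rank`,
their differentials `δ`, and the images `B i s` in `T` of the elements `y_i e_s`. -/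
structure GenData (Q : Type u) [CommRing Q] (T : Type v) where
  rank : ℕ
  δ : ℕ → ℕ × ℕ →₀ TateAlgebra Q
  B : ℕ → ℕ → T

instance [Zero T] : Inhabited (GenData Q T) := ⟨⟨0, fun _ => 0, fun _ _ => 0⟩⟩

namespace GenData

variable (p : ℕ → GenData Q T)

/-- The indices of the elements `y_i e_s` of degree `m`. -/
def degSet (m : ℕ) : Set (Σ _ : ℕ × ℕ, ℕ) := {q | q.1.2 < (p q.1.1).rank ∧ q.2 + q.1.1 = m}

/-- The indices of the elements `y_i e_s` where the degree of `e_s` is less than `n`. -/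
def lowSet (n : ℕ) : Set (Σ _ : ℕ × ℕ, ℕ) := {q | q.1.2 < (p q.1.1).rank ∧ q.1.1 < n}

/-- The differential of the semi-free dg module. -/
def D (f g : Q) : (ℕ × ℕ →₀ TateAlgebra Q) →ₗ[Q] (ℕ × ℕ →₀ TateAlgebra Q) :=
  freeD f g fun s => (p s.1).δ s.2

variable {p}

theorem D_smul {f g : Q} (hfg : f * g = 0) {i : ℕ} {a : TateAlgebra Q} (ha : a ∈ grading Q i)
    (x : ℕ × ℕ →₀ TateAlgebra Q) :
    D p f g (a • x) = diff f g a • x + (-1 : Q) ^ i • a • D p f g x :=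
  freeD_smul hfg _ ha x

theorem degSet_subset_lowSet {m n : ℕ} (h : m < n) : degSet p m ⊆ lowSet p n := by
  rintro q ⟨h1, h2⟩
  exact ⟨h1, by omega⟩

theorem eq_zero_of_mem_lowSet {S : Set (Σ _ : ℕ × ℕ, ℕ)} {n : ℕ} (hS : S ⊆ lowSet p n)
    {x : ℕ × ℕ →₀ TateAlgebra Q} (hx : x ∈ freeSpan Q S) {s : ℕ × ℕ} (hs : n ≤ s.1) : x s = 0 := by
  refine (yBasis Q).ext_elem fun i => ?_
  rw [map_zero, Finsupp.zero_apply]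
  by_contra h
  have := (hS (mem_freeSpan.1 hx ⟨s, i⟩ h)).2
  dsimp only at this
  omega

theorem degSet_congr {p' : ℕ → GenData Q T} {n : ℕ} (h : ∀ m ≤ n, p m = p' m) :
    degSet p n = degSet p' n := by
  ext q
  simp only [degSet, Set.mem_ofPred_eq]
  constructor
  · rintro ⟨h1, h2⟩; rw [← h q.1.1 (by omega)]; exact ⟨h1, h2⟩
  · rintro ⟨h1, h2⟩; rw [h q.1.1 (by omega)]; exact ⟨h1, h2⟩

theorem finite_degSet (p : ℕ → GenData Q T) (n : ℕ) : (degSet p n).Finite := by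
  have h : degSet p n ⊆ ⋃ j ∈ Finset.range (n + 1), ⋃ s ∈ Finset.range (p j).rank,
      {(⟨(j, s), n - j⟩ : Σ _ : ℕ × ℕ, ℕ)} := by
    rintro ⟨⟨j, s⟩, i⟩ ⟨h1, h2⟩
    dsimp only at h1 h2
    simp only [Set.mem_iUnion, Finset.mem_range]
    refine ⟨j, by omega, s, h1, ?_⟩
    obtain rfl : i = n - j := by omega
    rfl
  refine Set.Finite.subset ?_ h
  exact (Finset.range _).finite_toSet.biUnion fun j _ =>
    (Finset.range _).finite_toSet.biUnion fun s _ => Set.finite_singleton _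

end GenData

end GenData

/-! ### The comparison map and the lifting problem at stage n. -/

section Construction

variable {Q : Type u} [CommRing Q] {T : Type v} [AddCommGroup T] [Module Q T]

/-- The graded module `T = ⨁ 𝒯_n` with the differential `d` is a minimal complex of finite free
modules over a local ring, exact in positive degrees, and `f` annihilates its homology in
degree `0`. -/
structure IsMinimalExact [IsLocalRing Q] (f : Q) (𝒯 : ℕ → Submodule Q T) (d : T →ₗ[Q] T) :
    Prop where
  free : ∀ n, Module.Free Q (𝒯 n)
  finite : ∀ n, Module.Finite Q (𝒯 n)
  d_zero : ∀ x ∈ 𝒯 0, d x = 0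
  map_d_le : ∀ n, (𝒯 (n + 1)).map d ≤ IsLocalRing.maximalIdeal Q • 𝒯 n
  exact : ∀ n, ∀ x ∈ 𝒯 (n + 1), d x = 0 → ∃ z ∈ 𝒯 (n + 2), d z = x
  smul_mem : ∀ x ∈ 𝒯 0, ∃ z ∈ 𝒯 1, d z = f • x
  d_d : ∀ x, d (d x) = 0

namespace GenData

variable (p : ℕ → GenData Q T)

/-- The comparison map. -/
def eval : (ℕ × ℕ →₀ TateAlgebra Q) →ₗ[Q] T := freeEval fun i s => (p s.1).B i s.2

/-- The conditions on the generators of degree `n`. -/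
structure IsGood [IsLocalRing Q] (f g : Q) (𝒯 : ℕ → Submodule Q T) (d : T →ₗ[Q] T) (n : ℕ) :
    Prop where
  δ_zero : n = 0 → ∀ s < (p n).rank, (p n).δ s = 0
  δ_succ : ∀ m, n = m + 1 → ∀ s < (p n).rank,
    (p n).δ s ∈ IsLocalRing.maximalIdeal Q • freeSpan Q (degSet p m)
  B_mem : ∀ s < (p n).rank, ∀ i, (p n).B i s ∈ 𝒯 (i + n)
  d_B : ∀ s < (p n).rank, ∀ i,
    d ((p n).B i s) = eval p (D p f g (Finsupp.single (n, s) (y Q i)))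
  inj : ∀ x ∈ freeSpan Q (degSet p n), eval p x = 0 → x = 0
  surj : ∀ t ∈ 𝒯 n, ∃ x ∈ freeSpan Q (degSet p n), eval p x = t

variable {p}

theorem eval_single (s : ℕ × ℕ) (i : ℕ) :
    eval p (Finsupp.single s (y Q i)) = (p s.1).B i s.2 :=
  freeEval_single _ _ _

theorem eval_congr {p' : ℕ → GenData Q T} {n : ℕ} (h : ∀ m < n, p m = p' m)
    {S : Set (Σ _ : ℕ × ℕ, ℕ)} (hS : S ⊆ lowSet p n)
    {x : ℕ × ℕ →₀ TateAlgebra Q} (hx : x ∈ freeSpan Q S) : eval p x = eval p' x := by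
  refine freeEval_congr fun s hs i => ?_
  rw [h s.1 (not_le.1 fun hn => hs (eq_zero_of_mem_lowSet hS hx hn))]

section Low

variable [IsLocalRing Q] {f g : Q} {𝒯 : ℕ → Submodule Q T} {d : T →ₗ[Q] T} {n : ℕ}

theorem δ_mem_freeSpan {j : ℕ} (hp : IsGood p f g 𝒯 d (j + 1)) {s : ℕ}
    (hs : s < (p (j + 1)).rank) : (p (j + 1)).δ s ∈ freeSpan Q (degSet p j) :=
  Submodule.smul_le_right (hp.δ_succ j rfl s hs)

/-- Intersecting with `lowSet p n` keeps to the generators known at stage n, while the degree m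
itself may be n or larger. -/
theorem eval_mem (hp : ∀ m < n, IsGood p f g 𝒯 d m) {m : ℕ} {x : ℕ × ℕ →₀ TateAlgebra Q}
    (hx : x ∈ freeSpan Q (degSet p m ∩ lowSet p n)) : eval p x ∈ 𝒯 m := by
  suffices freeSpan Q (degSet p m ∩ lowSet p n) ≤ (𝒯 m).comap (eval p) from this hx
  refine freeSpan_le.2 fun s i hs => ?_
  rw [Submodule.mem_comap, eval_single]
  have := (hp s.1 hs.2.2).B_mem s.2 hs.1.1 i
  rwa [hs.1.2] at this

theorem D_single_mem {j s i m : ℕ} (hp : IsGood p f g 𝒯 d j) (hj : j < n)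
    (hs : s < (p j).rank) (hm : i + j = m + 1) :
    D p f g (Finsupp.single (j, s) (y Q i)) ∈ freeSpan Q (degSet p m ∩ lowSet p n) := by
  rcases j with _ | j
  · obtain rfl : i = m + 1 := hm
    rw [D, freeD_single_y_succ, hp.δ_zero rfl s hs, smul_zero, smul_zero, add_zero]
    exact Submodule.smul_mem _ _ (single_mem_freeSpan ⟨⟨hs, rfl⟩, hs, hj⟩)
  · have hδ := δ_mem_freeSpan hp hs
    have hδ' : y Q i • (p (j + 1)).δ s ∈ freeSpan Q (degSet p m ∩ lowSet p n) := by
      refine y_smul_mem_freeSpan (fun t k ht => ?_) hδ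
      have h2 := ht.2
      have h1 := ht.1
      dsimp only at h1 h2
      exact ⟨⟨h1, by dsimp only; omega⟩, h1, by dsimp only; omega⟩
    rcases i with _ | i
    · rw [D, freeD_single_y_zero]
      rwa [← one_def, one_smul] at hδ'
    · rw [D, freeD_single_y_succ]
      refine add_mem (Submodule.smul_mem _ _ (single_mem_freeSpan ?_))
        (Submodule.smul_mem _ _ hδ')
      exact ⟨⟨hs, by dsimp only; omega⟩, hs, hj⟩

theorem D_mem (hp : ∀ m < n, IsGood p f g 𝒯 d m) {m : ℕ} {x : ℕ × ℕ →₀ TateAlgebra Q}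
    (hx : x ∈ freeSpan Q (degSet p (m + 1) ∩ lowSet p n)) :
    D p f g x ∈ freeSpan Q (degSet p m ∩ lowSet p n) := by
  suffices freeSpan Q (degSet p (m + 1) ∩ lowSet p n) ≤
    (freeSpan Q (degSet p m ∩ lowSet p n)).comap (D p f g) from this hx
  exact freeSpan_le.2 fun s i hs => D_single_mem (hp s.1 hs.2.2) hs.2.2 hs.1.1 hs.1.2

theorem D_eq_zero (hp : ∀ m < n, IsGood p f g 𝒯 d m) {x : ℕ × ℕ →₀ TateAlgebra Q}
    (hx : x ∈ freeSpan Q (degSet p 0 ∩ lowSet p n)) : D p f g x = 0 := by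
  refine free_hom_ext (ψ := 0) (fun s i hs => ?_) hx
  obtain ⟨j, s⟩ := s
  have h2 := hs.1.2
  dsimp only at h2
  obtain rfl : i = 0 := by omega
  obtain rfl : j = 0 := by omega
  rw [D, freeD_single_y_zero, LinearMap.zero_apply]
  exact (hp 0 hs.2.2).δ_zero rfl s hs.1.1

theorem d_eval (hp : ∀ m < n, IsGood p f g 𝒯 d m) {x : ℕ × ℕ →₀ TateAlgebra Q}
    (hx : x ∈ freeSpan Q (lowSet p n)) : d (eval p x) = eval p (D p f g x) := by
  refine free_hom_ext (φ := d.comp (eval p)) (ψ := (eval p).comp (D p f g)) (fun s i hs => ?_) hx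
  rw [LinearMap.comp_apply, LinearMap.comp_apply, ← (hp s.1 hs.2).d_B s.2 hs.1 i, eval_single]

/-- Injectivity of `eval` one degree lower lets D x = 0 be tested in `T`. This spares a separate
proof of D² = 0: it is applied to the prescribed boundary of a new generator. -/
theorem D_eq_zero_of_d_eval (hp : ∀ m < n, IsGood p f g 𝒯 d m) {m : ℕ} (hm : m < n)
    {x : ℕ × ℕ →₀ TateAlgebra Q} (hx : x ∈ freeSpan Q (degSet p m)) (h : d (eval p x) = 0) :
    D p f g x = 0 := by
  have hx' : x ∈ freeSpan Q (degSet p m ∩ lowSet p n) :=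
    freeSpan_mono (Set.subset_inter subset_rfl (degSet_subset_lowSet hm)) hx
  rcases m with _ | m
  · exact D_eq_zero hp hx'
  · refine (hp m (by omega)).inj _ (freeSpan_mono Set.inter_subset_left (D_mem hp hx')) ?_
    rw [← d_eval hp (freeSpan_mono (degSet_subset_lowSet hm) hx), h]

/-- Modulo the maximal ideal, the comparison map is injective on the span of the elements
`y_i e_s` of degree `n` with `i ≥ 1`. -/
theorem mem_smul_of_eval_mem (hT : IsMinimalExact f 𝒯 d)
    (hf2 : f ∉ IsLocalRing.maximalIdeal Q ^ 2) (hg2 : g ∉ IsLocalRing.maximalIdeal Q ^ 2)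
    (hp : ∀ m < n, IsGood p f g 𝒯 d m)
    {x : ℕ × ℕ →₀ TateAlgebra Q} (hx : x ∈ freeSpan Q (degSet p n ∩ lowSet p n))
    (h : eval p x ∈ IsLocalRing.maximalIdeal Q • 𝒯 n) :
    x ∈ IsLocalRing.maximalIdeal Q • freeSpan Q (degSet p n ∩ lowSet p n) := by
  refine mem_smul_freeSpan hx ?_
  rcases n with _ | n
  · intro q
    rw [by_contra fun hq => Nat.not_lt_zero _ (mem_freeSpan.1 hx q hq).2.2]
    exact zero_mem _
  have hDx := D_mem hp hx
  have hDx' := freeSpan_mono Set.inter_subset_left hDx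
  -- Minimality contributes a second factor 𝔫.
  have hd : d (eval p x) ∈ (IsLocalRing.maximalIdeal Q ^ 2) • 𝒯 n := by
    have := Submodule.mem_map_of_mem (f := d) h
    rw [Submodule.map_smul''] at this
    rw [pow_two, Submodule.mul_smul]
    exact Submodule.smul_mono le_rfl (hT.map_d_le n) this
  have hle : 𝒯 n ≤ (freeSpan Q (degSet p n)).map (eval p) := by
    intro t ht
    obtain ⟨z, hz, rfl⟩ := (hp n n.lt_succ_self).surj t ht
    exact Submodule.mem_map_of_mem hz
  have hd' := Submodule.smul_mono le_rfl hle hd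
  rw [← Submodule.map_smul''] at hd'
  obtain ⟨z, hz, hzx⟩ := hd'
  -- Surjectivity of `eval` in degree n lifted the boundary to some z with coefficients in 𝔫²;
  -- injectivity identifies z with D x.
  have hDz : D p f g x = z := by
    refine sub_eq_zero.1 ((hp n n.lt_succ_self).inj _
      (sub_mem hDx' (Submodule.smul_le_right hz)) ?_)
    rw [map_sub, hzx, d_eval hp (freeSpan_mono Set.inter_subset_right hx), sub_self]
  have hsupp : ∀ s : ℕ × ℕ, x s ≠ 0 → s.2 < (p s.1).rank ∧ s.1 < n + 1 := by
    intro s hs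
    by_contra hc
    refine hs ((yBasis Q).ext_elem fun i => ?_)
    rw [map_zero, Finsupp.zero_apply]
    by_contra h'
    exact hc (mem_freeSpan.1 hx ⟨s, i⟩ h').2
  refine repr_mem_maximalIdeal_of_freeD hf2 hg2 Prod.fst (fun s => (p s.1).δ s.2) (n + 1) x
    (fun q hq => ?_) (fun s hs k q hq => ?_) (fun s hs k q => ?_) (fun q => ?_)
  · have h1 := mem_freeSpan.1 hx q hq
    have h2 := h1.1.2
    have h3 := h1.2.2
    omega
  · obtain ⟨hs1, hs2⟩ := hsupp s hs
    obtain ⟨j, s⟩ := s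
    rcases j with _ | j
    · rw [(hp 0 hs2).δ_zero rfl s hs1, smul_zero, map_zero, Finsupp.zero_apply]
    · have hδ := eq_zero_of_mem_lowSet (degSet_subset_lowSet j.lt_succ_self)
        (δ_mem_freeSpan (hp _ hs2) hs1) hq
      rw [freeBasis_repr_apply, Finsupp.smul_apply, hδ, smul_zero, map_zero, Finsupp.zero_apply]
  · obtain ⟨hs1, hs2⟩ := hsupp s hs
    obtain ⟨j, s⟩ := s
    rcases j with _ | j
    · rw [(hp 0 hs2).δ_zero rfl s hs1, smul_zero, map_zero, Finsupp.zero_apply]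
      exact zero_mem _
    · exact repr_mem_of_mem_smul_top
        (y_smul_mem_smul_top ((hp (j + 1) hs2).δ_succ j rfl s hs1) k) q
  · change (freeBasis Q _).repr (D p f g x) q ∈ _
    rw [hDz]
    exact repr_mem_of_mem_smul_top hz q

/-- The images of the elements `y_i e`, for a new generator `e` mapping to `t`. -/
theorem exists_lifts (hT : IsMinimalExact f 𝒯 d) (hfg : f * g = 0)
    (hp : ∀ m < n, IsGood p f g 𝒯 d m) {t : T} (ht : t ∈ 𝒯 n)
    {δ : ℕ × ℕ →₀ TateAlgebra Q} (hδ0 : n = 0 → δ = 0)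
    (hδ : ∀ m, n = m + 1 → δ ∈ freeSpan Q (degSet p m)) (hδt : eval p δ = d t) :
    ∃ b : ℕ → T, b 0 = t ∧ (∀ i, b i ∈ 𝒯 (i + n)) ∧
      ∀ i, d (b (i + 1)) = coeff f g (i + 1) • b i +
        (-1 : Q) ^ (i + 1) • eval p (y Q (i + 1) • δ) := by
  have hcc : ∀ i, coeff f g (i + 1) * coeff f g i = 0 := by
    intro i
    unfold coeff
    rcases Nat.even_or_odd i with h | h
    · rw [if_pos h.add_one, if_neg (Nat.not_odd_iff_even.2 h), hfg]
    · rw [if_neg (Nat.not_odd_iff_even.2 h.add_one), if_pos h, mul_comm, hfg]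
  have hyδ : ∀ k m, k + n = m + 1 → y Q k • δ ∈ freeSpan Q (degSet p m ∩ lowSet p n) := by
    intro k m hkm
    rcases n with _ | n
    · rw [hδ0 rfl, smul_zero]; exact zero_mem _
    · refine y_smul_mem_freeSpan (fun s i hs => ?_) (hδ n rfl)
      have h2 := hs.2
      have h1 := hs.1
      dsimp only at h1 h2
      exact ⟨⟨h1, by dsimp only; omega⟩, h1, by dsimp only; omega⟩
  have hDδ : D p f g δ = 0 := by
    rcases n with _ | n
    · rw [hδ0 rfl, map_zero]
    · refine D_eq_zero_of_d_eval hp n.lt_succ_self (hδ n rfl) ?_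
      rw [hδt, hT.d_d]
  -- The invariant prescribes d b_i only after multiplication by f_{i+1}. That is all the cycle
  -- condition at the next step needs, and since f_{i+1} f_i = 0 it forgets the term f_i b_{i-1}, so
  -- that i = 0 is not exceptional.
  obtain ⟨b, hb0, hbP, hbR⟩ := exists_seq_of_step
    (fun i x => x ∈ 𝒯 (i + n) ∧
      coeff f g (i + 1) • d x = coeff f g (i + 1) • (-1 : Q) ^ i • eval p (y Q i • δ))
    (fun i x x' => d x' = coeff f g (i + 1) • x +
        (-1 : Q) ^ (i + 1) • eval p (y Q (i + 1) • δ)) (z := t)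
    ⟨by rwa [zero_add], by rw [← one_def, one_smul, pow_zero, one_smul, hδt]⟩ (by
      rintro i x ⟨hx, hdx⟩
      have key : ∃ z ∈ 𝒯 (i + 1 + n), d z = coeff f g (i + 1) • x +
          (-1 : Q) ^ (i + 1) • eval p (y Q (i + 1) • δ) := by
        -- In total degree 0 there is no exactness to use; the required boundary is then just f x,
        -- and f annihilates the homology there.
        rcases Nat.eq_zero_or_pos (i + n) with h0 | h0
        · obtain rfl : i = 0 := by omega
          obtain rfl : n = 0 := by omega
          obtain ⟨z, hz, hdz⟩ := hT.smul_mem x hx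
          refine ⟨z, hz, ?_⟩
          rw [hdz, hδ0 rfl, smul_zero, map_zero, smul_zero, add_zero]
          simp [coeff]
        · obtain ⟨m, hm⟩ := Nat.exists_eq_add_of_lt h0
          rw [zero_add] at hm
          have hmem := hyδ (i + 1) (m + 1) (by omega)
          have : i + 1 + n = m + 2 := by omega
          rw [this]
          rw [hm] at hx
          refine hT.exact m _ (add_mem (Submodule.smul_mem _ _ hx)
            (Submodule.smul_mem _ _ (eval_mem hp hmem))) ?_
          -- The right-hand side is a cycle: by Leibniz and Dδ = 0, the boundary of the second term
          -- cancels that of the first.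
          rw [map_add, d.map_smul, hdx, d.map_smul,
            d_eval hp (freeSpan_mono Set.inter_subset_right hmem), D,
            freeD_smul hfg _ (y_mem_grading (i + 1))]
          change _ + _ • eval p (_ + _ • y Q (i + 1) • D p f g δ) = 0
          rw [hDδ, smul_zero, smul_zero, add_zero, diff_y_succ, smul_assoc, (eval p).map_smul,
            smul_comm (coeff f g (i + 1)), pow_succ, mul_neg_one, neg_smul, add_neg_cancel]
      obtain ⟨z, hz, hdz⟩ := key
      refine ⟨z, ⟨hz, ?_⟩, hdz⟩
      rw [hdz, smul_add, smul_smul, hcc, zero_smul, zero_add])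
  exact ⟨b, hb0, fun i => (hbP i).1, hbR⟩

end Low

end GenData
end Construction

/-! ### The inductive step and the existence of all generators. -/

namespace GenData

section Existence

variable {Q : Type u} [CommRing Q] [IsLocalRing Q] {T : Type v} [AddCommGroup T] [Module Q T]
  {f g : Q} {𝒯 : ℕ → Submodule Q T} {d : T →ₗ[Q] T} {p p' : ℕ → GenData Q T} {n : ℕ}

theorem D_single_mem_lowSet {j s : ℕ} (hp : IsGood p f g 𝒯 d j) (hs : s < (p j).rank) (i : ℕ) :
    D p f g (Finsupp.single (j, s) (y Q i)) ∈ freeSpan Q (lowSet p (j + 1)) := by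
  rcases Nat.eq_zero_or_pos (i + j) with h | h
  · obtain rfl : i = 0 := by omega
    obtain rfl : j = 0 := by omega
    rw [D, freeD_single_y_zero, hp.δ_zero rfl s hs]
    exact zero_mem _
  · obtain ⟨m, hm⟩ := Nat.exists_eq_add_of_lt h
    exact freeSpan_mono Set.inter_subset_right
      (D_single_mem (m := m) hp j.lt_succ_self hs (by omega))

/-- Elements of degree n, and the boundaries of the y_i e_s with e_s of degree n, involve only
generators of degree at most n. This is the locality required by `exists_seq_of_local`. -/
theorem IsGood.congr (h : ∀ m ≤ n, p m = p' m) (hp : IsGood p f g 𝒯 d n) :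
    IsGood p' f g 𝒯 d n := by
  have hn := h n le_rfl
  have hdeg : ∀ m ≤ n, degSet p' m = degSet p m := fun m hm =>
    (degSet_congr fun k hk => h k (hk.trans hm)).symm
  have heval : ∀ {S : Set (Σ _ : ℕ × ℕ, ℕ)}, S ⊆ lowSet p (n + 1) →
      ∀ {x : ℕ × ℕ →₀ TateAlgebra Q}, x ∈ freeSpan Q S → eval p' x = eval p x :=
    fun hS _ hx => (eval_congr (fun m hm => h m (Nat.lt_succ_iff.1 hm)) hS hx).symm
  refine ⟨fun h0 s hs => ?_, fun m hm s hs => ?_, fun s hs i => ?_, fun s hs i => ?_,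
    fun x hx hx0 => ?_, fun t ht => ?_⟩
  · rw [← hn] at hs ⊢
    exact hp.δ_zero h0 s hs
  · rw [← hn] at hs ⊢
    rw [hdeg m (by omega)]
    exact hp.δ_succ m hm s hs
  · rw [← hn] at hs ⊢
    exact hp.B_mem s hs i
  · rw [← hn] at hs ⊢
    have hD : D p' f g (Finsupp.single (n, s) (y Q i)) =
        D p f g (Finsupp.single (n, s) (y Q i)) := by
      rw [D, D, freeD_single_y, freeD_single_y, hn]
    rw [hD, heval subset_rfl (D_single_mem_lowSet hp hs i)]
    exact hp.d_B s hs i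
  · rw [hdeg n le_rfl] at hx
    rw [heval (degSet_subset_lowSet n.lt_succ_self) hx] at hx0
    exact hp.inj x hx hx0
  · rw [hdeg n le_rfl]
    obtain ⟨x, hx, rfl⟩ := hp.surj t ht
    exact ⟨x, hx, heval (degSet_subset_lowSet n.lt_succ_self) hx⟩

/-- By minimality d t has coefficients in 𝔫, and `eval` is onto one degree lower, so the lift can be
taken with coefficients in 𝔫 as well. -/
theorem exists_differential (hT : IsMinimalExact f 𝒯 d) (hp : ∀ m < n, IsGood p f g 𝒯 d m)
    {t : T} (ht : t ∈ 𝒯 n) : ∃ δ : ℕ × ℕ →₀ TateAlgebra Q, (n = 0 → δ = 0) ∧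
      (∀ m, n = m + 1 → δ ∈ IsLocalRing.maximalIdeal Q • freeSpan Q (degSet p m)) ∧
      eval p δ = d t := by
  rcases n with _ | n
  · refine ⟨0, fun _ => rfl, fun m hm => by omega, ?_⟩
    rw [map_zero, hT.d_zero t ht]
  · have hle : 𝒯 n ≤ (freeSpan Q (degSet p n)).map (eval p) := by
      intro t ht
      obtain ⟨z, hz, rfl⟩ := (hp n n.lt_succ_self).surj t ht
      exact Submodule.mem_map_of_mem hz
    have h := Submodule.smul_mono le_rfl hle (hT.map_d_le n (Submodule.mem_map_of_mem ht))
    rw [← Submodule.map_smul''] at h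
    obtain ⟨δ, hδ, hδt⟩ := h
    refine ⟨δ, fun h => by omega, fun m hm => ?_, hδt⟩
    obtain rfl : n = m := by omega
    exact hδ

/-- The span N of the y_i e_s of degree n over old generators is split off in 𝒯_n, and a basis of a
complement becomes the set of new generators. -/
theorem exists_next (hT : IsMinimalExact f 𝒯 d) (hfg : f * g = 0)
    (hf2 : f ∉ IsLocalRing.maximalIdeal Q ^ 2) (hg2 : g ∉ IsLocalRing.maximalIdeal Q ^ 2)
    (p : ℕ → GenData Q T) (n : ℕ) (hp : ∀ m < n, IsGood p f g 𝒯 d m) :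
    ∃ x, IsGood (Function.update p n x) f g 𝒯 d n := by
  set N := freeSpan Q (degSet p n ∩ lowSet p n)
  have : Module.Free Q N := freeSpan_free _
  have : Module.Finite Q N := freeSpan_finite ((finite_degSet p n).subset Set.inter_subset_left)
  have := hT.free n
  have := hT.finite n
  let φ : N →ₗ[Q] 𝒯 n := ((eval p).domRestrict N).codRestrict (𝒯 n) fun x => eval_mem hp x.2
  have hφ : ∀ z, (φ z : T) = eval p z := fun _ => rfl
  obtain ⟨r, e, hinj, hsurj⟩ := exists_complement_of_injective_mod φ (by
      intro x hx
      rw [Submodule.mem_smul_top_iff] at hx ⊢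
      exact mem_smul_of_eval_mem hT hf2 hg2 hp x.2 hx)
  choose δ hδ0 hδ hδe using fun s => exists_differential hT hp (e s).2
  choose b hb0 hb hdb using fun s => exists_lifts hT hfg hp (e s).2 (hδ0 s)
    (fun m hm => Submodule.smul_le_right (hδ s m hm)) (hδe s)
  let x : GenData Q T := ⟨r, fun s => if h : s < r then δ ⟨s, h⟩ else 0,
    fun i s => if h : s < r then b ⟨s, h⟩ i else 0⟩
  have hxδ : ∀ {s : ℕ} (h : s < r), x.δ s = δ ⟨s, h⟩ := fun h => dif_pos h
  have hxB : ∀ {s : ℕ} (h : s < r) (i : ℕ), x.B i s = b ⟨s, h⟩ i := fun h i => dif_pos h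
  set p' := Function.update p n x with hp'
  have hn : p' n = x := Function.update_self _ _ _
  have hagree : ∀ m < n, p m = p' m := fun m hm => (Function.update_of_ne hm.ne _ _).symm
  have heval : ∀ {S : Set (Σ _ : ℕ × ℕ, ℕ)}, S ⊆ lowSet p n →
      ∀ {x : ℕ × ℕ →₀ TateAlgebra Q}, x ∈ freeSpan Q S → eval p' x = eval p x :=
    fun hS _ hx => (eval_congr hagree hS hx).symm
  have hyδ : ∀ s k, y Q k • δ s ∈ freeSpan Q (lowSet p n) := by
    intro s k
    rcases Nat.eq_zero_or_pos n with h | h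
    · rw [hδ0 s h, smul_zero]; exact zero_mem _
    · obtain ⟨m, hm⟩ := Nat.exists_eq_add_of_lt h
      rw [zero_add] at hm
      refine y_smul_mem_freeSpan (fun s i hs => ?_) (Submodule.smul_le_right (hδ s m hm))
      exact ⟨hs.1, by have := hs.2; dsimp only at this ⊢; omega⟩
  let κ : (Fin r → Q) → (ℕ × ℕ →₀ TateAlgebra Q) :=
    fun c => ∑ s : Fin r, c s • Finsupp.single (n, (s : ℕ)) (y Q 0)
  have hκ : ∀ c, eval p' (κ c) = ∑ s, c s • (e s : T) := by
    intro c
    rw [map_sum]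
    refine Finset.sum_congr rfl fun s _ => ?_
    rw [map_smul, eval_single, hn, hxB s.2, hb0]
  -- In degree n a generator of degree n occurs only as y_0 e, so an element is an old part plus a
  -- Q-combination of new generators.
  have hdecomp : ∀ z ∈ freeSpan Q (degSet p' n), ∃ z₁ : N, ∃ c, z = z₁ + κ c := by
    intro z hz
    have hle : freeSpan Q (degSet p' n) ≤ N ⊔ LinearMap.range (Fintype.linearCombination Q
        fun s : Fin r => (Finsupp.single (n, (s : ℕ)) (y Q 0) : ℕ × ℕ →₀ TateAlgebra Q)) := by
      refine freeSpan_le.2 fun s i hs => ?_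
      obtain ⟨j, s⟩ := s
      obtain ⟨h1, h2⟩ := hs
      dsimp only at h1 h2
      rcases (show j ≤ n by omega).lt_or_eq with hj | rfl
      · rw [← hagree j hj] at h1
        exact Submodule.mem_sup_left (single_mem_freeSpan ⟨⟨h1, h2⟩, h1, hj⟩)
      · rw [hn] at h1
        obtain rfl : i = 0 := by omega
        refine Submodule.mem_sup_right ⟨Pi.single ⟨s, h1⟩ 1, ?_⟩
        rw [Fintype.linearCombination_apply_single, one_smul]
    obtain ⟨z₁, hz₁, _, ⟨c, rfl⟩, rfl⟩ := Submodule.mem_sup.1 (hle hz)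
    exact ⟨⟨z₁, hz₁⟩, c, by rw [Fintype.linearCombination_apply]⟩
  have hN' : ∀ (z₁ : N) c, eval p' (z₁ + κ c) = eval p z₁ + ∑ s, c s • (e s : T) := by
    intro z₁ c
    rw [map_add, hκ, heval Set.inter_subset_right z₁.2]
  refine ⟨x, fun h0 s hs => ?_, fun m hm s hs => ?_, fun s hs i => ?_, fun s hs i => ?_,
    fun z hz hz0 => ?_, fun t ht => ?_⟩
  · rw [← hp', hn] at hs ⊢
    rw [hxδ hs, hδ0 _ h0]
  · rw [← hp', hn] at hs ⊢
    rw [hxδ hs, ← degSet_congr (p := p) fun k hk => hagree k (by omega)]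
    exact hδ _ m hm
  · rw [← hp', hn] at hs ⊢
    rw [hxB hs]
    exact hb _ i
  · rw [← hp', hn] at hs ⊢
    rcases i with _ | i
    · rw [D, freeD_single_y_zero, hn, hxB hs, hb0, hxδ hs, ← hδe]
      have := hyδ ⟨s, hs⟩ 0
      rw [← one_def, one_smul] at this
      exact (heval subset_rfl this).symm
    · rw [D, freeD_single_y_succ, hn, hxB hs, hdb, hxδ hs, map_add, LinearMap.map_smul,
        LinearMap.map_smul, heval subset_rfl (hyδ _ _), eval_single, hn, hxB hs]
  · rw [← hp'] at hz hz0
    obtain ⟨z₁, c, rfl⟩ := hdecomp z hz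
    rw [hN'] at hz0
    obtain ⟨rfl, rfl⟩ := hinj z₁ c (Subtype.ext (by simpa [hφ] using hz0))
    simp [κ]
  · rw [← hp']
    obtain ⟨z₁, c, hzc⟩ := hsurj ⟨t, ht⟩
    refine ⟨z₁ + κ c, add_mem (freeSpan_mono ?_ z₁.2)
      (Submodule.sum_mem _ fun s _ => Submodule.smul_mem _ _ (single_mem_freeSpan ?_)), ?_⟩
    · rintro ⟨s, i⟩ ⟨⟨h1, h2⟩, -, h3⟩
      exact ⟨by rwa [← hagree _ h3], h2⟩
    · refine ⟨?_, zero_add n⟩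
      dsimp only
      rw [hn]
      exact s.2
    · rw [hN']
      simpa [hφ] using congrArg Subtype.val hzc

/-- A minimal exact complex is the underlying complex of a semi-free dg module over the Tate
construction. -/
theorem exists_isGood (hT : IsMinimalExact f 𝒯 d) (hfg : f * g = 0)
    (hf2 : f ∉ IsLocalRing.maximalIdeal Q ^ 2) (hg2 : g ∉ IsLocalRing.maximalIdeal Q ^ 2) :
    ∃ p : ℕ → GenData Q T, ∀ n, IsGood p f g 𝒯 d n :=
  exists_seq_of_local _ (fun _ _ _ h hp => hp.congr h) (exists_next hT hfg hf2 hg2)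

end Existence

end GenData

/-! ### The total complex of a minimal resolution. -/

section Total

variable {Q : Type u} [CommRing Q]

theorem lof_mem_totalDeg (U : ChainComplex (ModuleCat.{v} Q) ℕ) (n : ℕ) (x : U.X n) :
    DirectSum.lof Q ℕ (fun n => U.X n) n x ∈ totalDeg U n := ⟨x, rfl⟩

theorem lof_injective (U : ChainComplex (ModuleCat.{v} Q) ℕ) (n : ℕ) :
    Function.Injective (DirectSum.lof Q ℕ (fun n => U.X n) n) := by
  intro a b h
  have := congrArg (DirectSum.component Q ℕ (fun n => U.X n) n) h
  rwa [DirectSum.component.lof_self, DirectSum.component.lof_self] at this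

theorem lof_mem_smul {U : ChainComplex (ModuleCat.{v} Q) ℕ} {n : ℕ} {I : Ideal Q} {x : U.X n}
    (hx : x ∈ I • (⊤ : Submodule Q (U.X n))) :
    DirectSum.lof Q ℕ (fun n => U.X n) n x ∈ I • totalDeg U n := by
  have := Submodule.mem_map_of_mem (f := DirectSum.lof Q ℕ (fun n => U.X n) n) hx
  rwa [Submodule.map_smul'', Submodule.map_top] at this

/-- The projection of `U^#` onto its component of degree `n`. -/
def totalProj (U : ChainComplex (ModuleCat.{v} Q) ℕ) (n : ℕ) : Total U →ₗ[Q] Total U :=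
  (DirectSum.lof Q ℕ (fun n => U.X n) n).comp (DirectSum.component Q ℕ (fun n => U.X n) n)

theorem totalProj_of_mem {U : ChainComplex (ModuleCat.{v} Q) ℕ} {n : ℕ} {x : Total U}
    (hx : x ∈ totalDeg U n) : totalProj U n x = x := by
  obtain ⟨x, rfl⟩ := hx
  rw [totalProj, LinearMap.comp_apply, DirectSum.component.lof_self]

theorem totalProj_of_mem_ne {U : ChainComplex (ModuleCat.{v} Q) ℕ} {m n : ℕ} (h : m ≠ n)
    {x : Total U} (hx : x ∈ totalDeg U m) : totalProj U n x = 0 := by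
  obtain ⟨x, rfl⟩ := hx
  rw [totalProj, LinearMap.comp_apply, DirectSum.component.of, dif_neg h, map_zero]

theorem IsMinimalFreeResolution.isMinimalExact [IsLocalRing Q] {f : Q}
    {U : ChainComplex (ModuleCat.{v} Q) ℕ} {M : Type w} [AddCommGroup M] [Module Q M]
    {ε : U.X 0 →ₗ[Q] M} (hU : IsMinimalFreeResolution U ε) (hM : ∀ m : M, f • m = 0) :
    IsMinimalExact f (totalDeg U) (totalD U) where
  free n := by
    have := hU.free n
    exact Module.Free.of_equiv (LinearEquiv.ofInjective _ (lof_injective U n))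
  finite n := by
    have := hU.finite n
    exact Module.Finite.equiv (LinearEquiv.ofInjective _ (lof_injective U n))
  d_zero := by
    rintro _ ⟨x, rfl⟩
    exact totalD_lof_zero U x
  map_d_le n := by
    rintro _ ⟨_, ⟨x, rfl⟩, rfl⟩
    rw [totalD_lof_succ]
    exact lof_mem_smul (hU.minimal n ⟨x, rfl⟩)
  exact n := by
    rintro _ ⟨x, rfl⟩ hx
    rw [totalD_lof_succ] at hx
    obtain ⟨z, rfl⟩ := (hU.exact_succ n x).1 (lof_injective U n (hx.trans (map_zero _).symm))
    exact ⟨_, ⟨z, rfl⟩, totalD_lof_succ U (n + 1) z⟩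
  smul_mem := by
    rintro _ ⟨x, rfl⟩
    obtain ⟨z, hz⟩ := (hU.exact_zero (f • x)).1 (by rw [map_smul, hM])
    refine ⟨_, ⟨z, rfl⟩, ?_⟩
    rw [totalD_lof_succ, hz, map_smul]
  d_d := totalD_totalD U

end Total

/-! ### Transport of the A-module structure to U. -/

namespace GenData

section GenSet

variable {Q : Type u} [CommRing Q]

/-- The indices `s` of the generators `e_s`. -/
def genSet {T : Type v} (p : ℕ → GenData Q T) : Set (ℕ × ℕ) := {s | s.2 < (p s.1).rank}

/-- Two views of F: the A-submodule carries the module structure, the Q-span allows checks on the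
elements y_i e_s. -/
theorem mem_supported_genSet {T : Type v} {p : ℕ → GenData Q T} {x : ℕ × ℕ →₀ TateAlgebra Q} :
    x ∈ Finsupp.supported (TateAlgebra Q) (TateAlgebra Q) (genSet p) ↔
      x ∈ freeSpan Q {q : Σ _ : ℕ × ℕ, ℕ | q.1 ∈ genSet p} := by
  rw [Finsupp.mem_supported', mem_freeSpan]
  constructor
  · intro h q hq
    by_contra hc
    apply hq
    rw [freeBasis_repr_apply, h _ hc, map_zero, Finsupp.zero_apply]
  · intro h s hs
    refine (yBasis Q).ext_elem fun i => ?_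
    rw [map_zero, Finsupp.zero_apply]
    by_contra hc
    exact hs (h ⟨s, i⟩ hc)

end GenSet

section Structure

variable {Q : Type u} [CommRing Q] [IsLocalRing Q] {f g : Q}

variable {U : ChainComplex (ModuleCat.{v} Q) ℕ} {p : ℕ → GenData Q (Total U)}

theorem D_mem_supported (hp : ∀ n, IsGood p f g (totalDeg U) (totalD U) n)
    {x : ℕ × ℕ →₀ TateAlgebra Q}
    (hx : x ∈ Finsupp.supported (TateAlgebra Q) (TateAlgebra Q) (genSet p)) :
    D p f g x ∈ Finsupp.supported (TateAlgebra Q) (TateAlgebra Q) (genSet p) := by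
  rw [mem_supported_genSet] at hx ⊢
  suffices freeSpan Q {q : Σ _ : ℕ × ℕ, ℕ | q.1 ∈ genSet p} ≤
    (freeSpan Q {q : Σ _ : ℕ × ℕ, ℕ | q.1 ∈ genSet p}).comap (D p f g) from this hx
  refine freeSpan_le.2 fun s i hs => ?_
  exact freeSpan_mono (fun q hq => hq.1) (D_single_mem_lowSet (hp s.1) hs i)

theorem totalD_eval (hp : ∀ n, IsGood p f g (totalDeg U) (totalD U) n)
    {x : ℕ × ℕ →₀ TateAlgebra Q}
    (hx : x ∈ Finsupp.supported (TateAlgebra Q) (TateAlgebra Q) (genSet p)) :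
    totalD U (eval p x) = eval p (D p f g x) := by
  rw [mem_supported_genSet] at hx
  refine free_hom_ext (φ := (totalD U).comp (eval p)) (ψ := (eval p).comp (D p f g))
    (fun s i hs => ?_) hx
  rw [LinearMap.comp_apply, LinearMap.comp_apply, ← (hp s.1).d_B s.2 hs i, eval_single]

theorem eval_mem_totalDeg (hp : ∀ n, IsGood p f g (totalDeg U) (totalD U) n) {n : ℕ}
    {x : ℕ × ℕ →₀ TateAlgebra Q} (hx : x ∈ freeSpan Q (degSet p n)) :
    eval p x ∈ totalDeg U n := by
  suffices freeSpan Q (degSet p n) ≤ (totalDeg U n).comap (eval p) from this hx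
  refine freeSpan_le.2 fun s i hs => ?_
  rw [Submodule.mem_comap, eval_single]
  have := (hp s.1).B_mem s.2 hs.1 i
  rwa [hs.2] at this

/-- Injectivity is known degree by degree. Since `eval` commutes with the projections to homogeneous
components, each component of x is killed, hence zero. -/
theorem eval_eq_zero (hp : ∀ n, IsGood p f g (totalDeg U) (totalD U) n)
    {x : ℕ × ℕ →₀ TateAlgebra Q}
    (hx : x ∈ Finsupp.supported (TateAlgebra Q) (TateAlgebra Q) (genSet p))
    (h : eval p x = 0) : x = 0 := by
  rw [mem_supported_genSet] at hx
  classical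
  let π : ℕ → (ℕ × ℕ →₀ TateAlgebra Q) →ₗ[Q] (ℕ × ℕ →₀ TateAlgebra Q) := fun n =>
    (freeBasis Q (ℕ × ℕ)).constr Q fun q =>
      if q.2 + q.1.1 = n then Finsupp.single q.1 (y Q q.2) else 0
  have hπ : ∀ n s i, π n (Finsupp.single s (y Q i)) =
      if i + s.1 = n then Finsupp.single s (y Q i) else 0 := by
    intro n s i
    have := (freeBasis Q (ℕ × ℕ)).constr_basis Q (fun q =>
      if q.2 + q.1.1 = n then Finsupp.single q.1 (y Q q.2) else 0) ⟨s, i⟩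
    simpa only [freeBasis_apply] using this
  have hmem : ∀ n, π n x ∈ freeSpan Q (degSet p n) := by
    intro n
    suffices freeSpan Q {q : Σ _ : ℕ × ℕ, ℕ | q.1 ∈ genSet p} ≤
      (freeSpan Q (degSet p n)).comap (π n) from this hx
    refine freeSpan_le.2 fun s i hs => ?_
    rw [Submodule.mem_comap, hπ]
    split_ifs with hn
    · exact single_mem_freeSpan ⟨hs, hn⟩
    · exact zero_mem _
  have heval : ∀ n, eval p (π n x) = totalProj U n (eval p x) := by
    intro n
    refine free_hom_ext (φ := (eval p).comp (π n)) (ψ := (totalProj U n).comp (eval p))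
      (fun s i hs => ?_) hx
    have hB := (hp s.1).B_mem s.2 hs i
    rw [LinearMap.comp_apply, LinearMap.comp_apply, hπ, eval_single]
    split_ifs with hn
    · rw [eval_single, totalProj_of_mem (hn ▸ hB)]
    · rw [map_zero, totalProj_of_mem_ne hn hB]
  have hzero : ∀ n, π n x = 0 := fun n =>
    (hp n).inj _ (hmem n) (by rw [heval, h, map_zero])
  have hcoord : ∀ q, (freeBasis Q (ℕ × ℕ)).repr (π (q.2 + q.1.1) x) q =
      (freeBasis Q (ℕ × ℕ)).repr x q := by
    intro q
    refine free_hom_ext (φ := ((freeBasis Q (ℕ × ℕ)).coord q).comp (π (q.2 + q.1.1)))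
      (ψ := (freeBasis Q (ℕ × ℕ)).coord q) (fun s i hs => ?_) hx
    rw [LinearMap.comp_apply, hπ]
    split_ifs with hn
    · rfl
    · rw [map_zero, ← freeBasis_apply (Q := Q) (⟨s, i⟩ : Σ _ : ℕ × ℕ, ℕ),
        Module.Basis.coord_apply, Module.Basis.repr_self, Finsupp.single_eq_of_ne]
      rintro rfl
      exact hn rfl
  refine (freeBasis Q (ℕ × ℕ)).ext_elem fun q => ?_
  rw [← hcoord, hzero, map_zero]

theorem exists_eval_eq (hp : ∀ n, IsGood p f g (totalDeg U) (totalD U) n) (t : Total U) :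
    ∃ x ∈ Finsupp.supported (TateAlgebra Q) (TateAlgebra Q) (genSet p), eval p x = t := by
  induction t using DirectSum.induction_on with
  | zero => exact ⟨0, zero_mem _, map_zero _⟩
  | of n t =>
    obtain ⟨x, hx, hxt⟩ := (hp n).surj _ (lof_mem_totalDeg U n t)
    exact ⟨x, mem_supported_genSet.2 (freeSpan_mono (fun q hq => hq.1) hx), hxt⟩
  | add t t' ht ht' =>
    obtain ⟨x, hx, rfl⟩ := ht
    obtain ⟨x', hx', rfl⟩ := ht'
    exact ⟨x + x', add_mem hx hx', map_add _ _ _⟩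

theorem exists_dgModule (hfg : f * g = 0)
    (hp : ∀ n, IsGood p f g (totalDeg U) (totalD U) n) :
    ∃ _ : Module (TateAlgebra Q) (Total U),
      IsDGModule (grading Q) (diff f g) U ∧ IsSemifree (TateAlgebra Q) U := by
  let F := Finsupp.supported (TateAlgebra Q) (TateAlgebra Q) (genSet p)
  let φ : F →+ Total U := (eval p).toAddMonoidHom.comp F.subtype.toAddMonoidHom
  let e : F ≃+ Total U := AddEquiv.ofBijective φ ⟨by
    rw [injective_iff_map_eq_zero]
    exact fun x hx => Subtype.ext (eval_eq_zero hp x.2 hx), fun t => by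
      obtain ⟨x, hx, rfl⟩ := exists_eval_eq hp t
      exact ⟨⟨x, hx⟩, rfl⟩⟩
  have he : ∀ x : F, e x = eval p x := fun _ => rfl
  -- A acts on U through the bijection with F; the remaining claims are then statements about F
  -- pushed through `eval`.
  let _ : Module (TateAlgebra Q) (Total U) := e.symm.module (TateAlgebra Q)
  have hsmul : ∀ (a : TateAlgebra Q) (x : F), a • eval p x = eval p (a • x.1) := by
    intro a x
    change e (a • e.symm (e x)) = _
    rw [e.symm_apply_apply, he]; rfl
  refine ⟨inferInstance, ⟨⟨fun q a t => ?_⟩, fun i j a x ha hx => ?_, fun i a ha t => ?_⟩, ?_⟩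
  · obtain ⟨x, hx, rfl⟩ := exists_eval_eq hp t
    rw [hsmul _ ⟨x, hx⟩, hsmul _ ⟨x, hx⟩, smul_assoc, map_smul]
  · obtain ⟨c, rfl⟩ := Submodule.mem_span_singleton.1 ha
    obtain ⟨z, hz, rfl⟩ := (hp j).surj x hx
    have hz' := mem_supported_genSet.2
      (freeSpan_mono (S' := {q : Σ _ : ℕ × ℕ, ℕ | q.1 ∈ genSet p}) (fun q hq => hq.1) hz)
    rw [hsmul _ ⟨z, hz'⟩, smul_assoc, map_smul]
    have hyz : y Q i • z ∈ freeSpan Q (degSet p (i + j)) := by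
      refine y_smul_mem_freeSpan (S := degSet p j) (S' := degSet p (i + j))
        (fun s k hs => ⟨hs.1, ?_⟩) hz
      have := hs.2
      dsimp only at this ⊢
      omega
    exact Submodule.smul_mem _ _ (eval_mem_totalDeg hp hyz)
  · obtain ⟨x, hx, rfl⟩ := exists_eval_eq hp t
    have hs : ∀ z : Total U, (-1 : ℤ) ^ i • z = (-1 : Q) ^ i • z := by
      intro z
      rcases Nat.even_or_odd i with h | h <;> simp [h.neg_one_pow]
    rw [hs, totalD_eval hp hx, hsmul _ ⟨x, hx⟩, hsmul _ ⟨x, hx⟩, hsmul _ ⟨_, D_mem_supported hp hx⟩,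
      totalD_eval hp (F.smul_mem a hx), D_smul hfg ha, map_add,
      LinearMap.map_smul]
  · let eL : F ≃ₗ[TateAlgebra Q] Total U :=
      { e with
        map_smul' := fun a x => (hsmul a x).symm }
    -- `ULift` only moves the countable index set into the universe that `IsSemifree` asks for.
    let b : Module.Basis (ULift.{v} (genSet p)) (TateAlgebra Q) (Total U) :=
      (Module.Basis.ofRepr (eL.symm.trans
        (Finsupp.supportedEquivFinsupp (genSet p)))).reindex Equiv.ulift.symm
    refine ⟨_, fun s => s.down.1.1, b, fun s => ?_⟩
    have hb : b s = eval p (Finsupp.single s.down.1 (y Q 0)) := by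
      have h1 : b s = eL ((Finsupp.supportedEquivFinsupp (genSet p)).symm
        (Finsupp.single s.down 1)) := by
        rw [Module.Basis.reindex_apply, Module.Basis.coe_ofRepr]; rfl
      rw [h1]
      change eval p ((Finsupp.supportedEquivFinsupp (M := TateAlgebra Q) (R := TateAlgebra Q)
        (genSet p)).symm (Finsupp.single s.down 1)).1 = _
      rw [Finsupp.supportedEquivFinsupp_symm_single]; rfl
    rw [hb, eval_single]
    have := (hp s.down.1.1).B_mem s.down.1.2 s.down.2 0
    rwa [zero_add] at this

end Structure

end GenData

/-! ### Acyclicity of the kernel of A → R. -/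

section Acyclic

variable {Q : Type u} [CommRing Q] {f g : Q}

theorem augmentation_eq_mk (I : Ideal Q) (a : TateAlgebra Q) :
    augmentation I a = Ideal.Quotient.mk I ((yBasis Q).repr a 0) := by
  have h : (coeffZero Q).toLinearMap = (yBasis Q).coord 0 := by
    refine (yBasis Q).ext fun i => ?_
    change coeffZero Q (y Q i) = _
    rw [coeffZero_y, Module.Basis.coord_apply, Module.Basis.repr_self, Finsupp.single_apply]
  exact congrArg (Ideal.Quotient.mk I) (LinearMap.congr_fun h a)

theorem repr_diff (a : TateAlgebra Q) (i : ℕ) :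
    (yBasis Q).repr (diff f g a) i = coeff f g (i + 1) * (yBasis Q).repr a (i + 1) := by
  have h : ((yBasis Q).coord i).comp (diff f g) =
      coeff f g (i + 1) • (yBasis Q).coord (i + 1) := by
    refine (yBasis Q).ext fun k => ?_
    rw [LinearMap.comp_apply, LinearMap.smul_apply]
    change (yBasis Q).coord i (diff f g (y Q k)) = _
    rcases k with _ | k
    · rw [diff_y_zero, map_zero, Module.Basis.coord_apply, Module.Basis.repr_self,
        Finsupp.single_eq_of_ne (by omega), smul_zero]
    · rw [diff_y_succ, map_smul, y, Module.Basis.coord_apply, Module.Basis.coord_apply,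
        Module.Basis.repr_self, Module.Basis.repr_self]
      by_cases hk : k = i
      · subst hk; simp
      · rw [Finsupp.single_eq_of_ne (by omega), Finsupp.single_eq_of_ne (by omega), smul_zero,
          smul_zero]
  exact LinearMap.congr_fun h a

/-- For a pair of exact zero divisors, the kernel of the augmentation `A → R` is acyclic. -/
theorem exists_diff_eq (hfg : IsExactZeroDivisorPair f g) {a : TateAlgebra Q}
    (ha : diff f g a = 0) (ha0 : augmentation (Ideal.span {f}) a = 0) :
    ∃ c, augmentation (Ideal.span {f}) c = 0 ∧ diff f g c = a := by
  -- The coefficient at y_0 is in (f) because the augmentation kills a. The one at y_i with i ≥ 1 is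
  -- annihilated by f_i, and ann(f_i) = (f_{i+1}).
  have hr : ∀ i, ∃ r, (yBasis Q).repr a i = r * coeff f g (i + 1) := by
    intro i
    rcases i with _ | i
    · rw [augmentation_eq_mk, Ideal.Quotient.eq_zero_iff_mem, Ideal.mem_span_singleton'] at ha0
      obtain ⟨r, hr⟩ := ha0
      exact ⟨r, by rw [← hr]; simp [coeff]⟩
    · have h := repr_diff (f := f) (g := g) a i
      rw [ha, map_zero, Finsupp.zero_apply] at h
      have hann : (Ideal.span {coeff f g (i + 1)}).annihilator =
          Ideal.span {coeff f g (i + 1 + 1)} := by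
        unfold coeff
        rcases Nat.even_or_odd (i + 1) with h | h
        · rw [if_pos h.add_one, if_neg (Nat.not_odd_iff_even.2 h), hfg.2]
        · rw [if_neg (Nat.not_odd_iff_even.2 h.add_one), if_pos h, hfg.1]
      have hmem : (yBasis Q).repr a (i + 1) ∈ (Ideal.span {coeff f g (i + 1)}).annihilator := by
        rw [Submodule.mem_annihilator_span_singleton, smul_eq_mul, mul_comm, ← h]
      rw [hann, Ideal.mem_span_singleton'] at hmem
      obtain ⟨r, hr⟩ := hmem
      exact ⟨r, hr.symm⟩
  choose r hr using hr
  -- Dividing by f_{i+1} and raising each index by one; no y_0 term appears, so the augmentation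
  -- vanishes.
  refine ⟨∑ i ∈ ((yBasis Q).repr a).support, r i • y Q (i + 1), ?_, ?_⟩
  · rw [map_sum]
    refine Finset.sum_eq_zero fun i _ => ?_
    rw [map_smul, augmentation_y, if_neg (Nat.succ_ne_zero i), smul_zero]
  · rw [map_sum]
    conv_rhs => rw [← (yBasis Q).linearCombination_repr a]
    rw [Finsupp.linearCombination_apply, Finsupp.sum]
    refine Finset.sum_congr rfl fun i _ => ?_
    rw [map_smul, diff_y_succ, smul_smul, hr]; rfl

end Acyclic

/-! ### Acyclicity of the kernel of U → U ⊗_A R for semi-free U. -/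

section Semifree

variable {Q : Type u} [CommRing Q] {f g : Q} {U : ChainComplex (ModuleCat.{v} Q) ℕ}

theorem totalD_totalProj (n : ℕ) (x : Total U) :
    totalD U (totalProj U (n + 1) x) = totalProj U n (totalD U x) := by
  suffices h : (totalD U).comp (totalProj U (n + 1)) = (totalProj U n).comp (totalD U) from
    LinearMap.congr_fun h x
  refine DirectSum.linearMap_ext Q fun m => LinearMap.ext fun x => ?_
  simp only [LinearMap.comp_apply]
  have hx := lof_mem_totalDeg U m x
  rcases m with _ | m
  · rw [totalProj_of_mem_ne (by omega) hx, totalD_lof_zero, map_zero, map_zero]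
  · rw [totalD_lof_succ]
    have hx' := lof_mem_totalDeg U m ((U.d (m + 1) m).hom x)
    by_cases hm : m = n
    · subst hm
      rw [totalProj_of_mem hx, totalProj_of_mem hx', totalD_lof_succ]
    · rw [totalProj_of_mem_ne (by omega) hx, totalProj_of_mem_ne hm hx', map_zero]

theorem totalProj_mem (n : ℕ) (x : Total U) : totalProj U n x ∈ totalDeg U n := ⟨_, rfl⟩

variable [Module (TateAlgebra Q) (Total U)] {ι : Type v} {deg : ι → ℕ}
  {b : Module.Basis ι (TateAlgebra Q) (Total U)}

/-- The elements y_i b_s form a homogeneous Q-basis, with y_i b_s of degree i + deg s. -/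
theorem repr_totalProj (h : IsDGModule (grading Q) (diff f g) U)
    (hb : ∀ s, b s ∈ totalDeg U (deg s)) (n i : ℕ) (s : ι) (x : Total U) :
    (yBasis Q).repr (b.repr (totalProj U n x) s) i =
      if i + deg s = n then (yBasis Q).repr (b.repr x s) i else 0 := by
  have := h.isScalarTower
  let c := (yBasis Q).smulTower b
  have hc : ∀ q, c q ∈ totalDeg U (q.1 + deg q.2) := by
    intro q
    rw [Module.Basis.smulTower_apply]
    exact h.smul_mem (y_mem_grading q.1) (hb q.2)
  have hcoord : ∀ x, (yBasis Q).repr (b.repr x s) i = c.coord (i, s) x := fun x =>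
    (Module.Basis.smulTower_repr (yBasis Q) b x (i, s)).symm
  rw [hcoord, hcoord]
  split_ifs with hn
  · suffices hs : (c.coord (i, s)).comp (totalProj U n) = c.coord (i, s) from
      LinearMap.congr_fun hs x
    refine c.ext fun q => ?_
    rw [LinearMap.comp_apply]
    by_cases hq : q.1 + deg q.2 = n
    · rw [totalProj_of_mem (hq ▸ hc q)]
    · rw [totalProj_of_mem_ne hq (hc q), map_zero, Module.Basis.coord_apply,
        Module.Basis.repr_self, Finsupp.single_eq_of_ne]
      rintro rfl
      exact hq hn
  · suffices hs : (c.coord (i, s)).comp (totalProj U n) = 0 from LinearMap.congr_fun hs x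
    refine c.ext fun q => ?_
    rw [LinearMap.comp_apply, LinearMap.zero_apply]
    by_cases hq : q.1 + deg q.2 = n
    · rw [totalProj_of_mem (hq ▸ hc q), Module.Basis.coord_apply,
        Module.Basis.repr_self, Finsupp.single_eq_of_ne]
      rintro rfl
      exact hn hq
    · rw [totalProj_of_mem_ne hq (hc q), map_zero]

theorem repr_eq_zero_of_mem (h : IsDGModule (grading Q) (diff f g) U)
    (hb : ∀ s, b s ∈ totalDeg U (deg s)) {n i : ℕ} {s : ι} {x : Total U}
    (hx : x ∈ totalDeg U n) (hn : i + deg s ≠ n) : (yBasis Q).repr (b.repr x s) i = 0 := by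
  rw [← totalProj_of_mem hx, repr_totalProj h hb, if_neg hn]

theorem one_tmul_eq_zero_iff (b : Module.Basis ι (TateAlgebra Q) (Total U)) (x : Total U) :
    (1 ⊗ₜ x : BaseChange f U) = 0 ↔ ∀ s, augmentation (Ideal.span {f}) (b.repr x s) = 0 := by
  rw [← (b.baseChange (Q ⧸ Ideal.span {f})).forall_coord_eq_zero_iff]
  refine forall_congr' fun s => ?_
  rw [Module.Basis.coord_apply, Module.Basis.baseChange_repr_tmul, smul_quot_def, mul_one]

theorem one_tmul_totalProj (h : IsDGModule (grading Q) (diff f g) U)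
    (hb : ∀ s, b s ∈ totalDeg U (deg s)) (n : ℕ) {x : Total U}
    (hx : (1 ⊗ₜ x : BaseChange f U) = 0) : (1 ⊗ₜ totalProj U n x : BaseChange f U) = 0 := by
  rw [one_tmul_eq_zero_iff b] at hx ⊢
  intro s
  rw [augmentation_eq_mk, repr_totalProj h hb]
  split_ifs
  · rw [← augmentation_eq_mk, hx]
  · rw [map_zero]

/-- Degree reasons: ∂b_t has degree deg t - 1, below that of every y_i b_s. -/
theorem repr_totalD_basis (h : IsDGModule (grading Q) (diff f g) U)
    (hb : ∀ s, b s ∈ totalDeg U (deg s)) {s t : ι} (hst : deg t ≤ deg s) :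
    b.repr (totalD U (b t)) s = 0 := by
  refine (yBasis Q).ext_elem fun i => ?_
  rw [map_zero, Finsupp.zero_apply]
  have hbt := hb t
  rcases ht : deg t with _ | m
  · rw [ht] at hbt
    obtain ⟨x, hx⟩ := hbt
    rw [← hx, totalD_lof_zero, map_zero, Finsupp.zero_apply, map_zero, Finsupp.zero_apply]
  · rw [ht] at hbt
    obtain ⟨x, hx⟩ := hbt
    rw [← hx, totalD_lof_succ]
    exact repr_eq_zero_of_mem h hb (lof_mem_totalDeg U m _) (by omega)

theorem totalD_smul (h : IsDGModule (grading Q) (diff f g) U) (a : TateAlgebra Q) (x : Total U) :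
    totalD U (a • x) = diff f g a • x + signMap Q a • totalD U x := by
  have := h.isScalarTower
  let ρ : Total U → TateAlgebra Q →ₗ[Q] Total U := fun x =>
    (LinearMap.toSpanSingleton (TateAlgebra Q) (Total U) x).restrictScalars Q
  have key : (totalD U).comp (ρ x) =
      (ρ x).comp (diff f g) + (ρ (totalD U x)).comp (signMap Q) := by
    refine (yBasis Q).ext fun i => ?_
    change totalD U (y Q i • x) = diff f g (y Q i) • x + signMap Q (y Q i) • totalD U x
    rw [h.leibniz (y_mem_grading i), signMap_y, smul_assoc]
    congr 1
    rcases Nat.even_or_odd i with h | h <;> simp [h.neg_one_pow]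
  exact LinearMap.congr_fun key a

/-- Along basis elements of top degree the differential is that of A, because the ∂b_t contribute
only to lower ones. This describes the subquotients of the degree filtration. -/
theorem repr_totalD (h : IsDGModule (grading Q) (diff f g) U)
    (hb : ∀ s, b s ∈ totalDeg U (deg s)) {x : Total U} {s : ι}
    (hx : ∀ t, b.repr x t ≠ 0 → deg t ≤ deg s) :
    b.repr (totalD U x) s = diff f g (b.repr x s) := by
  classical
  conv_lhs => rw [← b.linearCombination_repr x]
  rw [Finsupp.linearCombination_apply, Finsupp.sum, map_sum, map_sum, Finsupp.finsetSum_apply]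
  have hterm : ∀ t ∈ (b.repr x).support, b.repr (totalD U (b.repr x t • b t)) s =
      if t = s then diff f g (b.repr x s) else 0 := by
    intro t ht
    rw [totalD_smul h, map_add, Finsupp.add_apply, map_smul, map_smul, Finsupp.smul_apply,
      Finsupp.smul_apply, repr_totalD_basis h hb (hx t (Finsupp.mem_support_iff.1 ht)), smul_zero,
      add_zero, Module.Basis.repr_self, Finsupp.single_apply]
    split_ifs with hts
    · rw [hts, smul_eq_mul, mul_one]
    · rw [smul_zero]
  rw [Finset.sum_congr rfl hterm, Finset.sum_ite_eq']
  split_ifs with hs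
  · rfl
  · rw [Finsupp.notMem_support_iff.1 hs, map_zero]

theorem one_tmul_totalD (h : IsDGModule (grading Q) (diff f g) U) {x : Total U}
    (hx : (1 ⊗ₜ x : BaseChange f U) = 0) : (1 ⊗ₜ totalD U x : BaseChange f U) = 0 := by
  rw [← baseChangeD_tmul h, hx, map_zero]

/-- For a pair of exact zero divisors, the kernel of `U → U ⊗_A R` is acyclic if `U` is
semi-free. -/
theorem exists_totalD_eq (hfg : IsExactZeroDivisorPair f g)
    (h : IsDGModule (grading Q) (diff f g) U) (hb : ∀ s, b s ∈ totalDeg U (deg s))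
    {x : Total U} (hx : (1 ⊗ₜ x : BaseChange f U) = 0) (hdx : totalD U x = 0) :
    ∃ z : Total U, (1 ⊗ₜ z : BaseChange f U) = 0 ∧ totalD U z = x := by
  classical
  -- Induction along the filtration: x involves only basis elements of degree less than N.
  have key : ∀ N : ℕ, ∀ x : Total U, (∀ s, b.repr x s ≠ 0 → deg s < N) →
      (1 ⊗ₜ x : BaseChange f U) = 0 → totalD U x = 0 →
      ∃ z : Total U, (1 ⊗ₜ z : BaseChange f U) = 0 ∧ totalD U z = x := by
    intro N
    induction N with
    | zero =>
      intro x hxN _ _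
      refine ⟨0, TensorProduct.tmul_zero _ _, ?_⟩
      rw [map_zero]
      refine (b.ext_elem fun s => ?_).symm
      rw [map_zero, Finsupp.zero_apply]
      exact by_contra fun hs => Nat.not_lt_zero _ (hxN s hs)
    | succ N ih =>
      intro x hxN hx hdx
      have haug := (one_tmul_eq_zero_iff b x).1 hx
      have hc : ∀ s, ∃ c, augmentation (Ideal.span {f}) c = 0 ∧
          (deg s = N → diff f g c = b.repr x s) := by
        intro s
        by_cases hs : deg s = N
        · obtain ⟨c, hc0, hc⟩ := exists_diff_eq (f := f) (g := g) hfg (a := b.repr x s) (by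
            rw [← repr_totalD h hb fun t ht => by have := hxN t ht; omega, hdx, map_zero,
              Finsupp.zero_apply]) (haug s)
          exact ⟨c, hc0, fun _ => hc⟩
        · exact ⟨0, map_zero _, fun hs' => absurd hs' hs⟩
      choose c hc0 hc using hc
      let z : Total U := ∑ s ∈ (b.repr x).support with deg s = N, c s • b s
      have hz : ∀ s, b.repr z s = if b.repr x s ≠ 0 ∧ deg s = N then c s else 0 := by
        intro s
        simp only [z, map_sum, map_smul, Module.Basis.repr_self, Finsupp.finsetSum_apply,
          Finsupp.smul_apply, Finsupp.single_apply, smul_eq_mul, mul_ite, mul_one, mul_zero,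
          Finset.sum_ite_eq', Finset.mem_filter, Finsupp.mem_support_iff]
      have hz0 : (1 ⊗ₜ z : BaseChange f U) = 0 := by
        rw [one_tmul_eq_zero_iff b]
        intro s
        rw [hz]
        split_ifs
        · exact hc0 s
        · exact map_zero _
      have hzN : ∀ t, b.repr z t ≠ 0 → deg t = N := by
        intro t ht
        rw [hz] at ht
        by_contra hne
        exact ht (if_neg fun h => hne h.2)
      -- The top coefficients of x are cycles in the kernel of the augmentation, so z was chosen to
      -- have ∂z with the same ones; x - ∂z lies one filtration step lower.
      obtain ⟨w, hw0, hw⟩ := ih (x - totalD U z) (fun s hs => by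
          by_contra hsN
          apply hs
          rw [map_sub, Finsupp.sub_apply,
            repr_totalD h hb fun t ht => by have := hzN t ht; omega, hz]
          by_cases hxs : b.repr x s = 0
          · rw [if_neg (fun h => h.1 hxs), map_zero, hxs, sub_zero]
          · have hsN' : deg s = N := by have := hxN s hxs; omega
            rw [if_pos ⟨hxs, hsN'⟩, hc s hsN', sub_self])
        (by rw [TensorProduct.tmul_sub, hx, one_tmul_totalD h hz0, sub_zero])
        (by rw [map_sub, hdx, totalD_totalD, sub_zero])
      refine ⟨w + z, ?_, ?_⟩
      · rw [TensorProduct.tmul_add, hw0, hz0, add_zero]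
      · rw [map_add, hw, sub_add_cancel]
  exact key ((b.repr x).support.sup deg + 1) x (fun s hs => Nat.lt_succ_of_le
    (Finset.le_sup (f := deg) (Finsupp.mem_support_iff.2 hs))) hx hdx

end Semifree

/-! ### U ⊗_A R is a minimal free resolution. -/

section Resolution

variable {Q : Type u} [CommRing Q] {f g : Q} {U : ChainComplex (ModuleCat.{v} Q) ℕ}
  [Module (TateAlgebra Q) (Total U)]

theorem mk_smul_one_tmul (h : IsDGModule (grading Q) (diff f g) U) (q : Q) (x : Total U) :
    (Ideal.Quotient.mk (Ideal.span {f}) q • (1 ⊗ₜ x) : BaseChange f U) = 1 ⊗ₜ (q • x) := by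
  have := h.isScalarTower
  have h1 : Ideal.Quotient.mk (Ideal.span {f}) q =
      (q • (1 : TateAlgebra Q)) • (1 : Q ⧸ Ideal.span {f}) := by
    rw [smul_quot_def, mul_one, map_smul, map_one, Algebra.smul_def, mul_one]; rfl
  rw [TensorProduct.smul_tmul', smul_eq_mul, mul_one, h1, TensorProduct.smul_tmul, smul_assoc,
    one_smul]

/-- The map `U_n → (U ⊗_A R)_n` as a semilinear map. -/
def toBaseChangeLinear (h : IsDGModule (grading Q) (diff f g) U) (n : ℕ) :
    U.X n →ₛₗ[Ideal.Quotient.mk (Ideal.span {f})] (baseChangeComplex h).X n where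
  toFun := toBaseChange h n
  map_add' x x' := Subtype.ext (by
    change (1 ⊗ₜ _ : BaseChange f U) = 1 ⊗ₜ _ + 1 ⊗ₜ _
    rw [map_add, TensorProduct.tmul_add])
  map_smul' q x := Subtype.ext (by
    change (1 ⊗ₜ _ : BaseChange f U) = Ideal.Quotient.mk (Ideal.span {f}) q • (1 ⊗ₜ _)
    rw [map_smul, mk_smul_one_tmul h])

theorem toBaseChange_eq_iff (h : IsDGModule (grading Q) (diff f g) U) {n : ℕ} {x x' : U.X n} :
    toBaseChange h n x = toBaseChange h n x' ↔
      (1 ⊗ₜ DirectSum.lof Q ℕ (fun n => U.X n) n x : BaseChange f U) =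
        1 ⊗ₜ DirectSum.lof Q ℕ (fun n => U.X n) n x' :=
  Subtype.ext_iff

/-- Scalars of R lift to Q, so the R-span of the elements 1 ⊗ x consists of such elements. -/
theorem toBaseChange_surjective (h : IsDGModule (grading Q) (diff f g) U) (n : ℕ) :
    Function.Surjective (toBaseChange h n) := by
  rintro ⟨z, hz⟩
  have key : ∃ x : U.X n, 1 ⊗ₜ DirectSum.lof Q ℕ (fun n => U.X n) n x = z := by
    induction hz using Submodule.span_induction with
    | mem z hz => exact hz
    | zero => exact ⟨0, by rw [map_zero, TensorProduct.tmul_zero]⟩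
    | add z z' _ _ hz hz' =>
      obtain ⟨x, rfl⟩ := hz
      obtain ⟨x', rfl⟩ := hz'
      exact ⟨x + x', by rw [map_add, TensorProduct.tmul_add]⟩
    | smul r z _ hz =>
      obtain ⟨x, rfl⟩ := hz
      obtain ⟨q, rfl⟩ := Ideal.Quotient.mk_surjective r
      exact ⟨q • x, by rw [map_smul, mk_smul_one_tmul h]⟩
  obtain ⟨x, hx⟩ := key
  exact ⟨x, Subtype.ext hx⟩

theorem baseChangeComplex_d_toBaseChange (h : IsDGModule (grading Q) (diff f g) U) (n : ℕ)
    (x : U.X (n + 1)) : ((baseChangeComplex h).d (n + 1) n).hom (toBaseChange h (n + 1) x) =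
      toBaseChange h n ((U.d (n + 1) n).hom x) := by
  have hd : (baseChangeComplex h).d (n + 1) n =
      ModuleCat.ofHom ((baseChangeD h).restrict (baseChangeD_mem h n)) :=
    ChainComplex.of_d (fun n => ModuleCat.of (Q ⧸ Ideal.span {f}) (baseChangeDeg f U n))
      (fun n => ModuleCat.ofHom ((baseChangeD h).restrict (baseChangeD_mem h n))) n
  rw [hd]
  refine Subtype.ext ?_
  change baseChangeD h (1 ⊗ₜ DirectSum.lof Q ℕ (fun n => U.X n) (n + 1) x) = _
  rw [baseChangeD_tmul, totalD_lof_succ]; rfl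

variable {ι : Type v} {deg : ι → ℕ} {b : Module.Basis ι (TateAlgebra Q) (Total U)}

/-- Each y_i with i ≥ 1 acts as zero on R, so only the 1 ⊗ b_s with deg s = n survive in degree n,
and they form a basis. -/
theorem free_baseChangeDeg (h : IsDGModule (grading Q) (diff f g) U)
    (hb : ∀ s, b s ∈ totalDeg U (deg s)) (n : ℕ) :
    Module.Free (Q ⧸ Ideal.span {f}) (baseChangeDeg f U n) := by
  let c := b.baseChange (Q ⧸ Ideal.span {f})
  have hc : baseChangeDeg f U n =
      Submodule.span _ (Set.range fun s : {s | deg s = n} => c s) := by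
    rw [← Set.image_eq_range]
    refine le_antisymm (Submodule.span_le.2 ?_) (Submodule.span_le.2 ?_)
    · rintro _ ⟨x, rfl⟩
      rw [SetLike.mem_coe, Module.Basis.mem_span_image]
      intro s hs
      by_contra hn
      rw [Finset.mem_coe, Finsupp.mem_support_iff] at hs
      apply hs
      rw [Module.Basis.baseChange_repr_tmul, smul_quot_def, mul_one, augmentation_eq_mk,
        repr_eq_zero_of_mem h hb (lof_mem_totalDeg U n x) (by rwa [zero_add]), map_zero]
    · rintro _ ⟨s, rfl, rfl⟩
      obtain ⟨x, hx⟩ := hb s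
      refine Submodule.subset_span ⟨x, ?_⟩
      dsimp only
      rw [Module.Basis.baseChange_apply, hx]
  rw [hc]
  exact Module.Free.of_basis (Module.Basis.span
    (c.linearIndependent.comp _ Subtype.val_injective))

theorem IsExactZeroDivisorPair.exact_baseChangeComplex (hfg : IsExactZeroDivisorPair f g)
    (h : IsDGModule (grading Q) (diff f g) U) (hb : ∀ s, b s ∈ totalDeg U (deg s)) (n : ℕ)
    (hU : Function.Exact (U.d (n + 2) (n + 1)).hom (U.d (n + 1) n).hom) :
    Function.Exact ((baseChangeComplex h).d (n + 2) (n + 1)).hom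
      ((baseChangeComplex h).d (n + 1) n).hom := by
  intro z
  obtain ⟨x, rfl⟩ := toBaseChange_surjective h (n + 1) z
  constructor
  · intro hz
    rw [baseChangeComplex_d_toBaseChange] at hz
    have hz' : (1 ⊗ₜ DirectSum.lof Q ℕ (fun n => U.X n) n ((U.d (n + 1) n).hom x) :
        BaseChange f U) = 0 :=
      congrArg (fun w : baseChangeDeg f U n => (w : BaseChange f U)) hz
    rw [← totalD_lof_succ] at hz'
    obtain ⟨w, hw0, hw⟩ := exists_totalD_eq hfg h hb hz' (totalD_totalD U _)
    -- The correction w need not be homogeneous. Its component of degree n + 1 still dies in U ⊗_A R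
    -- and has the same boundary as x, so x minus it is a cycle of U with the same image.
    obtain ⟨x', hx'⟩ : DirectSum.lof Q ℕ (fun n => U.X n) (n + 1) x - totalProj U (n + 1) w ∈
        totalDeg U (n + 1) := sub_mem (lof_mem_totalDeg U _ x) (totalProj_mem _ _)
    have hdx' : (U.d (n + 1) n).hom x' = 0 := by
      apply lof_injective U n
      rw [← totalD_lof_succ, hx', map_sub, totalD_totalProj, hw, totalD_lof_succ,
        totalProj_of_mem (lof_mem_totalDeg U n _), sub_self, map_zero]
    obtain ⟨t, rfl⟩ := (hU x').1 hdx'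
    refine ⟨toBaseChange h (n + 2) t, ?_⟩
    rw [baseChangeComplex_d_toBaseChange, toBaseChange_eq_iff, hx', TensorProduct.tmul_sub,
      one_tmul_totalProj h hb _ hw0, sub_zero]
  · rintro ⟨w, hw⟩
    rw [← hw]
    exact congrArg (fun φ => φ.hom w) ((baseChangeComplex h).d_comp_d (n + 2) (n + 1) n)

/-- In degree 0 only the y_0 b_s with deg s = 0 occur, and their coefficients vanish modulo f. -/
theorem mem_smul_top_of_one_tmul_eq_zero (h : IsDGModule (grading Q) (diff f g) U)
    (hb : ∀ s, b s ∈ totalDeg U (deg s)) {x : U.X 0}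
    (hx : (1 ⊗ₜ DirectSum.lof Q ℕ (fun n => U.X n) 0 x : BaseChange f U) = 0) :
    x ∈ Ideal.span {f} • (⊤ : Submodule Q (U.X 0)) := by
  have := h.isScalarTower
  have hmem : DirectSum.lof Q ℕ (fun n => U.X n) 0 x ∈ Ideal.span {f} • totalDeg U 0 := by
    rw [← ((yBasis Q).smulTower b).linearCombination_repr
      (DirectSum.lof Q ℕ (fun n => U.X n) 0 x), Finsupp.linearCombination_apply]
    refine Submodule.sum_mem _ fun q hq => ?_
    obtain ⟨i, s⟩ := q
    rw [Finsupp.mem_support_iff, Module.Basis.smulTower_repr] at hq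
    have his : i + deg s = 0 := by_contra fun hc =>
      hq (repr_eq_zero_of_mem h hb (lof_mem_totalDeg U 0 x) hc)
    obtain rfl : i = 0 := by omega
    have hs : deg s = 0 := by omega
    refine Submodule.smul_mem_smul ?_ ?_
    · have := (one_tmul_eq_zero_iff b _).1 hx s
      rw [augmentation_eq_mk, Ideal.Quotient.eq_zero_iff_mem] at this
      rwa [Module.Basis.smulTower_repr]
    · rw [Module.Basis.smulTower_apply]
      change y Q 0 • b s ∈ _
      rw [← one_def, one_smul, ← hs]
      exact hb s
  rw [totalDeg, ← Submodule.map_top, ← Submodule.map_smul''] at hmem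
  obtain ⟨x', hx', he⟩ := hmem
  rwa [← lof_injective U 0 he]

theorem IsMinimalFreeResolution.baseChangeComplex [IsLocalRing Q]
    [IsLocalRing (Q ⧸ Ideal.span {f})] {M : Type w} [AddCommGroup M] [Module Q M]
    [Module (Q ⧸ Ideal.span {f}) M] [IsScalarTower Q (Q ⧸ Ideal.span {f}) M]
    {ε : U.X 0 →ₗ[Q] M} (hU : IsMinimalFreeResolution U ε) (hfg : IsExactZeroDivisorPair f g)
    (h : IsDGModule (grading Q) (diff f g) U) (hb : ∀ s, b s ∈ totalDeg U (deg s)) :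
    ∃ ε' : (baseChangeComplex h).X 0 →ₗ[Q ⧸ Ideal.span {f}] M,
      (∀ x : U.X 0, ε' (toBaseChange h 0 x) = ε x) ∧
        IsMinimalFreeResolution (DGTate.baseChangeComplex h) ε' := by
  have hM : ∀ (q : Q) (m : M), Ideal.Quotient.mk (Ideal.span {f}) q • m = q • m := by
    intro q m
    rw [← algebraMap_smul (Q ⧸ Ideal.span {f}) q m]; rfl
  have hker : ∀ x x', toBaseChange h 0 x = toBaseChange h 0 x' → ε x = ε x' := by
    intro x x' hxx
    rw [toBaseChange_eq_iff, ← sub_eq_zero, ← TensorProduct.tmul_sub, ← map_sub] at hxx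
    rw [← sub_eq_zero, ← map_sub]
    have h1 := mem_smul_top_of_one_tmul_eq_zero h hb hxx
    suffices Ideal.span {f} • (⊤ : Submodule Q (U.X 0)) ≤ LinearMap.ker ε from this h1
    refine Submodule.smul_le.2 fun r hr m _ => ?_
    rw [LinearMap.mem_ker, map_smul, ← hM, Ideal.Quotient.eq_zero_iff_mem.2 hr, zero_smul]
  -- A merely set-theoretic section; linearity of the induced augmentation follows because `hker`
  -- makes it independent of the chosen lifts.
  let inv := Function.surjInv (toBaseChange_surjective h 0)
  have hinv : ∀ z, toBaseChange h 0 (inv z) = z :=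
    Function.surjInv_eq (toBaseChange_surjective h 0)
  let ε' : (DGTate.baseChangeComplex h).X 0 →ₗ[Q ⧸ Ideal.span {f}] M :=
    { toFun := fun z => ε (inv z)
      map_add' := fun z z' => by
        rw [← map_add]
        refine hker _ _ ?_
        rw [hinv]
        exact ((map_add (toBaseChangeLinear h 0) _ _).trans
          (congrArg₂ _ (hinv z) (hinv z'))).symm
      map_smul' := fun r z => by
        obtain ⟨q, rfl⟩ := Ideal.Quotient.mk_surjective r
        rw [RingHom.id_apply, hM, ← map_smul]
        refine hker _ _ ?_
        rw [hinv]
        exact ((map_smulₛₗ (toBaseChangeLinear h 0) q _).trans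
          (congrArg (_ • ·) (hinv z))).symm }
  have hε' : ∀ x, ε' (toBaseChange h 0 x) = ε x := fun x => hker _ _ (hinv _)
  refine ⟨ε', hε', ⟨fun n => free_baseChangeDeg h hb n, fun n => ?_, fun n =>
    hfg.exact_baseChangeComplex h hb n (hU.exact_succ n), fun z => ?_, fun m => ?_, fun n => ?_⟩⟩
  · have := hU.finite n
    exact Module.Finite.of_surjective (toBaseChangeLinear h n) (toBaseChange_surjective h n)
  · obtain ⟨x, rfl⟩ := toBaseChange_surjective h 0 z
    rw [hε', hU.exact_zero x]
    constructor
    · rintro ⟨t, rfl⟩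
      exact ⟨toBaseChange h 1 t, baseChangeComplex_d_toBaseChange h 0 t⟩
    · rintro ⟨w, hw⟩
      obtain ⟨t, rfl⟩ := toBaseChange_surjective h 1 w
      rw [baseChangeComplex_d_toBaseChange h 0 t] at hw
      have h1 := hker _ _ hw
      exact (hU.exact_zero x).1 (h1.symm.trans ((hU.exact_zero _).2 ⟨t, rfl⟩))
  · obtain ⟨x, rfl⟩ := hU.surjective m
    exact ⟨_, hε' x⟩
  · rintro _ ⟨w, rfl⟩
    obtain ⟨t, rfl⟩ := toBaseChange_surjective h (n + 1) w
    rw [baseChangeComplex_d_toBaseChange]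
    have hloc : IsLocalHom (Ideal.Quotient.mk (Ideal.span {f})) :=
      .of_surjective _ Ideal.Quotient.mk_surjective
    have hle : ∀ x ∈ IsLocalRing.maximalIdeal Q • (⊤ : Submodule Q (U.X n)),
        toBaseChangeLinear h n x ∈ IsLocalRing.maximalIdeal (Q ⧸ Ideal.span {f}) •
          (⊤ : Submodule (Q ⧸ Ideal.span {f}) ((DGTate.baseChangeComplex h).X n)) := by
      intro x hx
      induction hx using Submodule.smul_induction_on' with
      | smul r hr x _ =>
        rw [map_smulₛₗ]
        exact Submodule.smul_mem_smul (map_nonunit _ r hr) trivial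
      | add x _ x' _ hx hx' =>
        rw [map_add]
        exact add_mem hx hx'
    exact hle _ (hU.minimal n ⟨t, rfl⟩)

end Resolution

end DGTate

end

theorem theorem2p1 {Q : Type u} [CommRing Q] [IsLocalRing Q] [IsNoetherianRing Q] (f g : Q)
    (hf : f ∈ IsLocalRing.maximalIdeal Q) (hf2 : f ∉ IsLocalRing.maximalIdeal Q ^ 2)
    (hg : g ∈ IsLocalRing.maximalIdeal Q) (hg2 : g ∉ IsLocalRing.maximalIdeal Q ^ 2)
    (hfg : f * g = 0)
    (M : Type w) [AddCommGroup M] [Module Q M] [Module (Q ⧸ Ideal.span {f}) M]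
    [IsScalarTower Q (Q ⧸ Ideal.span {f}) M] [Module.Finite (Q ⧸ Ideal.span {f}) M]
    (U : ChainComplex (ModuleCat.{v} Q) ℕ) (ε : U.X 0 →ₗ[Q] M)
    (hU : DGTate.IsMinimalFreeResolution U ε) :
    (∃ _ : Module (DGTate.TateAlgebra Q) (DGTate.Total U),
      DGTate.IsDGModule (DGTate.TateAlgebra.grading Q) (DGTate.TateAlgebra.diff f g) U ∧
        DGTate.IsSemifree (DGTate.TateAlgebra Q) U) ∧
    (DGTate.IsExactZeroDivisorPair f g →
      haveI : IsLocalRing (Q ⧸ Ideal.span {f}) := DGTate.isLocalRing_quotient hf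
      ∀ [Module (DGTate.TateAlgebra Q) (DGTate.Total U)]
        (h : DGTate.IsDGModule (DGTate.TateAlgebra.grading Q) (DGTate.TateAlgebra.diff f g) U),
        DGTate.IsSemifree (DGTate.TateAlgebra Q) U →
          ∃ ε' : (DGTate.baseChangeComplex h).X 0 →ₗ[Q ⧸ Ideal.span {f}] M,
            (∀ x : U.X 0, ε' (DGTate.toBaseChange h 0 x) = ε x) ∧
              DGTate.IsMinimalFreeResolution (DGTate.baseChangeComplex h) ε') := by
  refine ⟨?_, fun hfg' => ?_⟩
  -- The only fact about the R-structure of M that part (a) needs.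
  · have hM : ∀ m : M, f • m = 0 := by
      intro m
      rw [← algebraMap_smul (Q ⧸ Ideal.span {f}) f m, Ideal.Quotient.algebraMap_eq,
        Ideal.Quotient.eq_zero_iff_mem.2 (Ideal.mem_span_singleton_self f), zero_smul]
    obtain ⟨p, hp⟩ := DGTate.GenData.exists_isGood (hU.isMinimalExact hM) hfg hf2 hg2
    exact DGTate.GenData.exists_dgModule hfg hp
  · have : IsLocalRing (Q ⧸ Ideal.span {f}) := DGTate.isLocalRing_quotient hf
    intro _ h ⟨ι, deg, b, hb⟩
    exact hU.baseChangeComplex hfg' h hb
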